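/- Let $(X_t)_{t\in\mathbb Z}$ be a stationary stochastic process with values in a countable alphabet $A$, and let $Y_t=X_{-(t+1)}$ be its time reversal. Two pasts $\overleftarrow{x}=\dots x_{-2}x_{-1}$ are equivalent if they give the same conditional law of the future $X_{0:\infty}=X_0X_1\dots$; the equivalence classes $s_i$ of positive probability $\pi_i$ are the causal states. Assume that, for the process and for its time reversal, the causal states are discrete, i.e. $\sum_i\pi_i=1$. Let $S_t$ be the causal state of the past $\dots X_{t-2}X_{t-1}$, let $T^x_{ij}=P(X_0=x,\,S_1=s_j\mid S_0=s_i)$, and let the cryptic order $k\in\{0,1,2,\dots\}\cup\{\infty\}$ be the smallest $l$ with $H(S_l\mid X_{0:\infty})=0$ ($k=\infty$ if there is none). Put $|S_i(0)\rangle=|i\rangle$ and $$|S_i(l)\rangle=\sum_{x,j}\sqrt{T^x_{ij}}\;|x\rangle|S_j(l-1)\rangle\qquad(l\ge 1).$$ The internal states of the q-machine of the process are the vectors $|S_i\rangle=|S_i(k)\rangle$; they matter only up to an isometry, and for $k=\infty$ they are vectors of a Hilbert space with $\langle S_i|S_j\rangle=\lim_{l\to\infty}\langle S_i(l)|S_j(l)\rangle$.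 Let $\rho=\sum_i\pi_i|S_i\rangle\langle S_i|$, let $\bar C_q=-\operatorname{Tr}(\rho\log_2\rho)\in[0,\infty]$ be its von Neumann entropy (the q-machine complexity), and let $\bar D_q=\log_2\operatorname{Tr}(\rho^0)=\log_2\operatorname{rank}\rho\in[0,\infty]$ be its max entropy (the q-machine state complexity). Write $\bar C_q^+,\bar D_q^+$ for these quantities for $(X_t)$ and $\bar C_q^-,\bar D_q^-$ for those of the time reversal $(Y_t)$. Then $$\bar C_q^+=\bar C_q^-\qquad\text{and}\qquad \bar D_q^+=\bar D_q^- .$$ -/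

import Mathlib

open MeasureTheory ProbabilityTheory Filter Topology
open scoped ENNReal

noncomputable section

namespace QMachine

/-! ### Discrete-time stochastic processes -/

section Law

variable {A : Type*} [MeasurableSpace A]

/-- The observations `X_{t-1}, X_{t-2}, …` made strictly before time `t`, most recent first. -/
def pastAt (t : ℤ) (x : ℤ → A) : ℕ → A := fun n => x (t - 1 - n)

/-- The future `X_0, X_1, …` (`X_{0:∞}`). -/
def future (x : ℤ → A) : ℕ → A := fun n => x n

/-- A process is given by its law on `ℤ → A`.  It is stationary if that law is invariant under
all time translations. -/
def IsStationary (μ : Measure (ℤ → A)) : Prop :=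
  ∀ t : ℤ, μ.map (fun x s => x (s + t)) = μ

/-- The law of the time-reversed process `Y_t = X_{-(t+1)}`. -/
def timeReversal (μ : Measure (ℤ → A)) : Measure (ℤ → A) :=
  μ.map (fun x t => x (-(t + 1)))

instance (μ : Measure (ℤ → A)) [IsFiniteMeasure μ] : IsFiniteMeasure (timeReversal μ) := by
  unfold timeReversal; infer_instance

end Law

/-! ### Causal states -/

section CausalStates

variable {A : Type*} [Countable A] [Nonempty A] [MeasurableSpace A] [DiscreteMeasurableSpace A]
variable (μ : Measure (ℤ → A)) [IsFiniteMeasure μ]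

/-- The conditional law of the future given the past (a regular conditional distribution). -/
def futureLaw : Kernel (ℕ → A) (ℕ → A) := condDistrib future (pastAt 0) μ

/-- Two pasts are equivalent iff they have coinciding conditional futures. -/
def causalSetoid : Setoid (ℕ → A) := Setoid.ker fun p => futureLaw μ p

/-- The encoding map sending a past to its equivalence class. -/
def causalClass (p : ℕ → A) : Quotient (causalSetoid μ) := Quotient.mk _ p

/-- The event `S_t = s`, where `S_t` is the equivalence class of the past `… X_{t-2} X_{t-1}`;
the next symbol to be emitted is `X_t`. -/
def stateEvent (t : ℤ) (s : Quotient (causalSetoid μ)) : Set (ℤ → A) :=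
  {x | causalClass μ (pastAt t x) = s}

/-- The causal states: the equivalence classes that occur with positive probability. (The classes
of probability zero depend on the version of the conditional law and carry no weight.) -/
def CausalState : Type _ :=
  {s : Quotient (causalSetoid μ) // μ (stateEvent μ 0 s) ≠ 0}

/-- The process has a discrete collection of causal states: almost every past belongs to an
equivalence class of positive probability. -/
def HasDiscreteCausalStates : Prop :=
  ∀ᵐ x ∂μ, μ (stateEvent μ 0 (causalClass μ (pastAt 0 x))) ≠ 0

/-- The probability `π_i` of the causal state `s_i`. -/
def stateProb (i : CausalState μ) : ℝ := μ.real (stateEvent μ 0 i.1)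

/-- `T^x_{ij}`: the probability to emit `x` and move to `s_j`, given that the present state is
`s_i`. -/
def transProb (x : A) (i j : CausalState μ) : ℝ :=
  (cond μ (stateEvent μ 0 i.1)).real ({ω | ω 0 = x} ∩ stateEvent μ 1 j.1)

/-- The conditional Shannon entropy `H(S_l | X_{0:∞})`, in nats. -/
def condStateEntropy (l : ℕ) : ℝ≥0∞ :=
  ∫⁻ ω, ∑' i : CausalState μ, ENNReal.ofReal (Real.negMulLog
    ((μ[(stateEvent μ l i.1).indicator (fun _ => (1 : ℝ)) |
      MeasurableSpace.comap future inferInstance]) ω)) ∂μ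

/-- The cryptic order: the smallest `l` with `H(S_l | X_{0:∞}) = 0`, and `⊤` if there is none. -/
def crypticOrder : ℕ∞ := ⨅ (l : ℕ) (_ : condStateEntropy μ l = 0), (l : ℕ∞)

/-! ### The q-machine -/

/-- The Hilbert space with orthonormal basis `|x_0⟩ ⋯ |x_{l-1}⟩ |j⟩`, where `x_0 … x_{l-1}` runs
over all finite words and `j` over the causal states; words of length `l` span a copy of the
`l`-fold tensor power of `ℓ²(A)` tensored with `ℓ²(CausalState μ)`. -/
abbrev QSpace : Type _ := lp (fun _ : List A × CausalState μ => ℂ) 2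

variable {μ}

open Classical in
/-- The amplitudes of `|x⟩ ⊗ v`. -/
def ketConsFun (x : A) (v : List A × CausalState μ → ℂ) : List A × CausalState μ → ℂ
  | ([], _) => 0
  | (y :: w, j) => if y = x then v (w, j) else 0

theorem memℓp_ketConsFun (x : A) (v : QSpace μ) : Memℓp (ketConsFun x v) 2 := by
  have h2 : 0 < (2 : ℝ≥0∞).toReal := by norm_num
  have hv := (memℓp_gen_iff h2).1 (lp.memℓp v)
  rw [memℓp_gen_iff h2]
  let e : List A × CausalState μ → List A × CausalState μ := fun c => (x :: c.1, c.2)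
  have he : Function.Injective e := by
    rintro ⟨w, j⟩ ⟨w', j'⟩ h
    simpa [e] using h
  rw [← he.summable_iff]
  · refine hv.congr fun c => ?_
    simp [e, ketConsFun]
  · rintro ⟨w, j⟩ hc
    cases w with
    | nil => simp [ketConsFun]
    | cons y w =>
      have hy : y ≠ x := fun h => hc ⟨(w, j), by simp [e, h]⟩
      simp [ketConsFun, hy]

/-- The vector `|x⟩ ⊗ v`. -/
def ketCons (x : A) (v : QSpace μ) : QSpace μ := ⟨ketConsFun x v, memℓp_ketConsFun x v⟩

variable (μ)

open Classical in
/-- The vectors `|S_i(l)⟩`, with `|S_i(0)⟩ = |i⟩` and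
`|S_i(l+1)⟩ = ∑_{x,j} √(T^x_{ij}) |x⟩ |S_j(l)⟩`. -/
def qState : ℕ → CausalState μ → QSpace μ
  | 0, i => lp.single 2 ([], i) 1
  | l + 1, i => ∑' c : A × CausalState μ,
      (Real.sqrt (transProb μ c.1 i c.2) : ℂ) • ketCons c.1 (qState l c.2)

variable {H : Type*} [NormedAddCommGroup H] [InnerProductSpace ℂ H]

/-- `s` is a family of internal states of the q-machine, i.e. it is, up to an isometry, the family
`|S_i⟩ = |S_i(k)⟩` for the cryptic order `k`. If the cryptic order is infinite, this means that
the overlaps of the states are the limits of the overlaps of the `|S_i(l)⟩`. -/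
def IsQMachine (s : CausalState μ → H) : Prop :=
  (∀ k : ℕ, crypticOrder μ = k →
    ∀ i j, inner ℂ (s i) (s j) = inner ℂ (qState μ k i) (qState μ k j)) ∧
  (crypticOrder μ = ⊤ →
    ∀ i j, Tendsto (fun l => inner ℂ (qState μ l i) (qState μ l j)) atTop
      (𝓝 (inner ℂ (s i) (s j))))

/-- At finite cryptic order `k` the vectors `|S_i(k)⟩` are internal states of the q-machine. -/
theorem isQMachine_qState {k : ℕ} (hk : crypticOrder μ = k) : IsQMachine μ (qState μ k) := by
  refine ⟨fun k' hk' i j => ?_, fun h => ?_⟩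
  · rw [hk] at hk'
    rw [Nat.cast_inj.1 hk']
  · rw [hk] at h
    exact absurd h (ENat.natCast_ne_top k)

/-- The stationary state `ρ = ∑_i π_i |S_i⟩⟨S_i|` of a machine with internal states `s`. -/
def densityOperator (s : CausalState μ → H) : H →L[ℂ] H :=
  ∑' i, (stateProb μ i : ℂ) • InnerProductSpace.rankOne ℂ (s i) (s i)

end CausalStates

/-! ### Entropies of a density operator -/

section Entropy

variable {H : Type*} [NormedAddCommGroup H] [InnerProductSpace ℂ H]

/-- The von Neumann entropy `S(ρ) = -Tr(ρ log₂ ρ)` of a density operator, possibly infinite: the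
sum over the eigenvalues `r` of `ρ`, with multiplicity, of `-r log₂ r`. -/
def vonNeumannEntropy (ρ : H →L[ℂ] H) : ℝ≥0∞ :=
  ∑' r : ℝ, (Module.finrank ℂ (Module.End.eigenspace (ρ : H →ₗ[ℂ] H) (r : ℂ)) : ℝ≥0∞) *
    ENNReal.ofReal (-(r * Real.logb 2 r))

/-- The rank of `ρ`, i.e. `Tr(ρ⁰)` where `ρ⁰` is the projection onto the support of `ρ`. -/
def opRank (ρ : H →L[ℂ] H) : ℕ∞ := Cardinal.toENat (LinearMap.rank (ρ : H →ₗ[ℂ] H))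

/-- The max entropy `log₂ Tr(ρ⁰)`. -/
def maxEntropy (ρ : H →L[ℂ] H) : EReal :=
  ENNReal.log (opRank ρ : ℝ≥0∞) / (Real.log 2 : EReal)

end Entropy

section Complexity

variable {A : Type*} [Countable A] [Nonempty A] [MeasurableSpace A] [DiscreteMeasurableSpace A]
variable (μ : Measure (ℤ → A)) [IsFiniteMeasure μ]
variable {H : Type*} [NormedAddCommGroup H] [InnerProductSpace ℂ H]

/-- The q-machine complexity: the von Neumann entropy of the machine's stationary state. -/
def qComplexity (s : CausalState μ → H) : ℝ≥0∞ := vonNeumannEntropy (densityOperator μ s)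

/-- The q-machine state complexity: the max entropy of the machine's stationary state. -/
def qStateComplexity (s : CausalState μ → H) : EReal := maxEntropy (densityOperator μ s)

end Complexity

end QMachine

end

/-!
Let `S` be the causal state of the past and `R` the causal state of the reversed process, which is a
function of the future, both at time `0`, and let `p(i, a) = P(S = i, R = a)`. The vectors `√π_i
|S_i⟩` of the q-machine turn out to have the Gram matrix `G Gᵀ` with `G = (√p(i, a))`, and those of
the q-machine of the reversed process have the Gram matrix `Gᵀ G`. A density operator
`∑ |u_i⟩⟨u_i|` is `T† T` for the analysis operator `T x = (⟨u_i, x⟩)_i`, while `T T†` is the Gram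
matrix of `u`; as `T† T` and `T T†` have the same nonzero eigenvalues with the same multiplicities
and the same rank, both entropies agree (`entropies_eq_of_gram`).

The Gram matrix is found in three steps.

*Overlaps at level `l`.* By unifilarity (`exists_leads`) a word `w` emitted in the state `i` leads
almost surely to a definite state `k`, after which the future has the law attached to `k`. Hence
`|S_i(l)⟩` has the amplitude `√P(w | i)` at `|w⟩|k⟩` and vanishes elsewhere
(`qState_hasAmplitudes`). If `w` leads from `i` and from `j` to the same state, then the posterior
probabilities `P(S = i | X_{0:∞})` and `P(S = j | X_{0:∞})` are proportional on the cylinder of `w`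
(`posterior_proportional`), so `√π_i √π_j ⟨S_i(l)|S_j(l)⟩` is the integral of
`√(P(S = i | X_{0:∞}) P(S = j | X_{0:∞}))` over the futures whose first `l` symbols synchronize `i`
and `j` (`inner_qState`).

*Synchronization.* If the first `l` symbols lead from `i` and `j` to distinct states, and both `i`
and `j` are possible given the future, then the state at time `l` is uncertain given the future at
time `0`. So the integral over the remaining futures is controlled by
`∑_k E[Q_k (1 - Q_k)]`, `Q_k = P(S_l = k | X_{0:∞})` (`sq_integral_sub_le_uncertainty`). This
vanishes if `H(S_l | X_{0:∞}) = 0`, which settles a finite cryptic order. In general it tends to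
zero (`tendsto_uncertainty`): by stationarity it is the uncertainty about `S_0` given the
observations from time `-l` on, and these determine `S_0` in the limit, by Lévy's upward theorem.
Either way the overlap of the internal states is the integral over all futures
(`inner_internalState`).

*Reversal.* The conditional law of the past given the future depends on the future only through `R`.
If the causal states of the reversed process are discrete, the integral is therefore
`∑_a √p(i, a) √p(j, a)` (`hasSum_sqrt_jointProb`).
-/

noncomputable section

namespace QMachine

/-! ### Spectrum and rank of `T† T` and `T T†` -/

section LinearAlgebra

/-- For `r ≠ 0` the maps `f` and `r⁻¹ g` are mutually inverse between the `r`-eigenspaces of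
`g f` and `f g`. -/
def eigenspaceCompEquiv {K M N : Type*} [Field K] [AddCommGroup M] [Module K M]
    [AddCommGroup N] [Module K N] (f : M →ₗ[K] N) (g : N →ₗ[K] M) {r : K} (hr : r ≠ 0) :
    Module.End.eigenspace (g ∘ₗ f) r ≃ₗ[K] Module.End.eigenspace (f ∘ₗ g) r where
  toFun x := ⟨f x, by
    have hx := Module.End.mem_eigenspace_iff.1 x.2
    rw [LinearMap.comp_apply] at hx
    rw [Module.End.mem_eigenspace_iff, LinearMap.comp_apply, hx, map_smul]⟩
  map_add' x y := by ext; simp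
  map_smul' c x := by ext; simp
  invFun y := ⟨r⁻¹ • g y, by
    have hy := Module.End.mem_eigenspace_iff.1 y.2
    rw [LinearMap.comp_apply] at hy
    rw [Module.End.mem_eigenspace_iff, LinearMap.comp_apply, map_smul, map_smul, hy, map_smul,
      smul_comm]⟩
  left_inv x := by
    have hx := Module.End.mem_eigenspace_iff.1 x.2
    rw [LinearMap.comp_apply] at hx
    ext
    simp [hx, smul_smul, hr]
  right_inv y := by
    have hy := Module.End.mem_eigenspace_iff.1 y.2
    rw [LinearMap.comp_apply] at hy
    ext
    simp [hy, smul_smul, hr]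

variable {H K : Type*} [NormedAddCommGroup H] [InnerProductSpace ℂ H] [CompleteSpace H]
  [NormedAddCommGroup K] [InnerProductSpace ℂ K] [CompleteSpace K]

/-- The eigenvalue `0` carries no weight in the entropy, and `T† T` and `T T†` agree away
from it. -/
theorem vonNeumannEntropy_adjoint_comp_self (T : H →L[ℂ] K) :
    vonNeumannEntropy (T.adjoint ∘L T) = vonNeumannEntropy (T ∘L T.adjoint) := by
  refine tsum_congr fun r => ?_
  rcases eq_or_ne r 0 with rfl | hr
  · simp
  · congr 2
    exact (eigenspaceCompEquiv (T : H →ₗ[ℂ] K) (T.adjoint : K →ₗ[ℂ] H)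
      (Complex.ofReal_ne_zero.2 hr)).finrank_eq


/-- `T† T` and `T` have the same kernel, hence ranges of the same dimension. -/
theorem opRank_adjoint_comp_self_eq_rank (T : H →L[ℂ] K) :
    opRank (T.adjoint ∘L T) = Cardinal.toENat (LinearMap.rank (T : H →ₗ[ℂ] K)) := by
  have e : LinearMap.range ((T.adjoint ∘L T : H →L[ℂ] H) : H →ₗ[ℂ] H) ≃ₗ[ℂ]
      LinearMap.range (T : H →ₗ[ℂ] K) :=
    (LinearMap.quotKerEquivRange _).symm.trans
      ((Submodule.quotEquivOfEq _ _ T.ker_adjoint_comp_self).trans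
        (LinearMap.quotKerEquivRange _))
  unfold opRank LinearMap.rank
  rw [← Cardinal.toENat_lift, e.lift_rank_eq, Cardinal.toENat_lift]

/-- The range of `T T†` is contained in that of `T`. -/
theorem opRank_comp_adjoint_le (T : H →L[ℂ] K) :
    opRank (T ∘L T.adjoint) ≤ opRank (T.adjoint ∘L T) := by
  rw [opRank_adjoint_comp_self_eq_rank]
  exact Cardinal.toENat.monotone'
    (LinearMap.rank_comp_le_left (T.adjoint : K →ₗ[ℂ] H) (T : H →ₗ[ℂ] K))

theorem opRank_adjoint_comp_self (T : H →L[ℂ] K) :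
    opRank (T.adjoint ∘L T) = opRank (T ∘L T.adjoint) := by
  refine le_antisymm ?_ (opRank_comp_adjoint_le T)
  simpa using opRank_comp_adjoint_le T.adjoint

theorem maxEntropy_adjoint_comp_self (T : H →L[ℂ] K) :
    maxEntropy (T.adjoint ∘L T) = maxEntropy (T ∘L T.adjoint) := by
  unfold maxEntropy
  rw [opRank_adjoint_comp_self]

end LinearAlgebra

/-! ### The analysis operator of a square-summable family -/

section Analysis

variable {I J H K : Type*} [NormedAddCommGroup H] [InnerProductSpace ℂ H]
  [NormedAddCommGroup K] [InnerProductSpace ℂ K]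

theorem norm_inner_sq_le (u : I → H) (x : H) (i : I) :
    ‖inner ℂ (u i) x‖ ^ 2 ≤ ‖u i‖ ^ 2 * ‖x‖ ^ 2 := by
  rw [← mul_pow]
  gcongr
  exact norm_inner_le_norm _ _

theorem memℓp_inner {u : I → H} (hu : Summable fun i => ‖u i‖ ^ 2) (x : H) :
    Memℓp (fun i => inner ℂ (u i) x) 2 := by
  rw [memℓp_gen_iff (by norm_num)]
  simp only [ENNReal.toReal_ofNat, Real.rpow_ofNat]
  exact (hu.mul_right (‖x‖ ^ 2)).of_nonneg_of_le (fun i => by positivity)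
    fun i => norm_inner_sq_le u x i

/-- The analysis operator `x ↦ (⟨u_i, x⟩)_i` of a square-summable family of vectors. -/
def analysisOp (u : I → H) (hu : Summable fun i => ‖u i‖ ^ 2) :
    H →L[ℂ] lp (fun _ : I => ℂ) 2 :=
  LinearMap.mkContinuous
    { toFun := fun x => ⟨fun i => inner ℂ (u i) x, memℓp_inner hu x⟩
      map_add' := fun x y => by ext i; exact inner_add_right _ _ _
      map_smul' := fun c x => by ext i; exact inner_smul_right _ _ _ }
    (Real.sqrt (∑' i, ‖u i‖ ^ 2)) fun x => by
      refine le_of_sq_le_sq ?_ (by positivity)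
      have h := lp.norm_rpow_eq_tsum (p := 2) (by norm_num)
        (⟨fun i => inner ℂ (u i) x, memℓp_inner hu x⟩ : lp (fun _ : I => ℂ) 2)
      simp only [ENNReal.toReal_ofNat, Real.rpow_ofNat] at h
      rw [mul_pow, Real.sq_sqrt (by positivity)]
      refine h.trans_le ?_
      rw [← tsum_mul_right]
      refine Summable.tsum_le_tsum (fun i => norm_inner_sq_le u x i) ?_ (hu.mul_right _)
      exact (hu.mul_right (‖x‖ ^ 2)).of_nonneg_of_le (fun i => by positivity)
        fun i => norm_inner_sq_le u x i

@[simp] theorem analysisOp_apply (u : I → H) (hu : Summable fun i => ‖u i‖ ^ 2) (x : H) (i : I) :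
    analysisOp u hu x i = inner ℂ (u i) x := rfl

variable [CompleteSpace H] [CompleteSpace K]

theorem tsum_rankOne_eq_adjoint_comp (u : I → H) (hu : Summable fun i => ‖u i‖ ^ 2) :
    ∑' i, InnerProductSpace.rankOne ℂ (u i) (u i)
      = (analysisOp u hu).adjoint ∘L analysisOp u hu := by
  have hs : Summable fun i => InnerProductSpace.rankOne ℂ (u i) (u i) := by
    refine Summable.of_norm (hu.congr fun i => ?_)
    rw [InnerProductSpace.norm_rankOne, sq]
  ext x
  refine ext_inner_left ℂ fun y => ?_
  rw [ContinuousLinearMap.comp_apply, ContinuousLinearMap.adjoint_inner_right, lp.inner_eq_tsum]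
  have h1 := (hs.hasSum.mapL (ContinuousLinearMap.apply ℂ H x)).mapL (innerSL ℂ y)
  refine h1.tsum_eq.symm.trans (tsum_congr fun i => ?_)
  simp [mul_comm]

/-- `T_u T_u†` is the Gram matrix of the family `u`, so families in different spaces with the same
Gram matrix have the same `T_u T_u†`. -/
theorem analysisOp_comp_adjoint_congr (u : I → H) (hu : Summable fun i => ‖u i‖ ^ 2)
    (v : I → K) (hv : Summable fun i => ‖v i‖ ^ 2)
    (h : ∀ i j, inner ℂ (u i) (u j) = inner ℂ (v i) (v j)) :
    analysisOp u hu ∘L (analysisOp u hu).adjoint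
      = analysisOp v hv ∘L (analysisOp v hv).adjoint := by
  ext x i
  simp only [ContinuousLinearMap.comp_apply, analysisOp_apply,
    ContinuousLinearMap.adjoint_inner_right]
  congr 1
  ext j
  simp [h]

/-- The analysis operator of the rows of a real matrix is adjoint to that of its columns. -/
theorem analysisOp_adjoint_eq (g : I → J → ℝ) (v : I → lp (fun _ : J => ℂ) 2)
    (hv : Summable fun i => ‖v i‖ ^ 2) (w : J → lp (fun _ : I => ℂ) 2)
    (hw : Summable fun a => ‖w a‖ ^ 2) (hvg : ∀ i a, v i a = g i a) (hwg : ∀ i a, w a i = g i a) :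
    (analysisOp v hv).adjoint = analysisOp w hw := by
  classical
  ext y a
  have h1 : ((analysisOp v hv).adjoint y) a
      = inner ℂ (lp.single 2 a (1 : ℂ)) ((analysisOp v hv).adjoint y) := by
    rw [lp.inner_single_left]; simp
  rw [h1, ContinuousLinearMap.adjoint_inner_right, analysisOp_apply]
  congr 1
  ext i
  rw [analysisOp_apply, lp.inner_single_right]
  simp [hvg, hwg]

end Analysis

section DensityComparison

variable {I J H K : Type*} [NormedAddCommGroup H] [InnerProductSpace ℂ H] [CompleteSpace H]
  [NormedAddCommGroup K] [InnerProductSpace ℂ K] [CompleteSpace K]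

/-- If `T` and `T'` are analysis operators of `u` and `u'`, and the Gram matrices of `u` and `u'`
are `G Gᵀ` and `Gᵀ G` for one real matrix `G`, then `∑ |u_i⟩⟨u_i|` and `∑ |u'_a⟩⟨u'_a|` have equal
entropies: `T† T ∼ T T† = G Gᵀ ∼ Gᵀ G = T' T'† ∼ T'† T'`. -/
theorem entropies_eq_of_gram (g : I → J → ℝ) (u : I → H) (u' : J → K)
    (hu : Summable fun i => ‖u i‖ ^ 2) (hu' : Summable fun a => ‖u' a‖ ^ 2)
    (hG : ∀ i j, HasSum (fun a => g i a * g j a : J → ℝ) (inner ℂ (u i) (u j)).re)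
    (hGim : ∀ i j, (inner ℂ (u i) (u j)).im = 0)
    (hG' : ∀ a b, HasSum (fun i => g i a * g i b : I → ℝ) (inner ℂ (u' a) (u' b)).re)
    (hGim' : ∀ a b, (inner ℂ (u' a) (u' b)).im = 0) :
    vonNeumannEntropy (∑' i, InnerProductSpace.rankOne ℂ (u i) (u i))
      = vonNeumannEntropy (∑' a, InnerProductSpace.rankOne ℂ (u' a) (u' a)) ∧
    maxEntropy (∑' i, InnerProductSpace.rankOne ℂ (u i) (u i))
      = maxEntropy (∑' a, InnerProductSpace.rankOne ℂ (u' a) (u' a)) := by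
  have hvm : ∀ i, Memℓp (fun a => (g i a : ℂ)) 2 := fun i => by
    rw [memℓp_gen_iff (by norm_num)]
    refine (hG i i).summable.congr fun a => ?_
    simp [← sq]
  have hwm : ∀ a, Memℓp (fun i => (g i a : ℂ)) 2 := fun a => by
    rw [memℓp_gen_iff (by norm_num)]
    refine (hG' a a).summable.congr fun i => ?_
    simp [← sq]
  let v : I → lp (fun _ : J => ℂ) 2 := fun i => ⟨_, hvm i⟩
  let w : J → lp (fun _ : I => ℂ) 2 := fun a => ⟨_, hwm a⟩
  have huv : ∀ i j, inner ℂ (u i) (u j) = inner ℂ (v i) (v j) := fun i j => by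
    rw [lp.inner_eq_tsum]
    have h1 : inner ℂ (u i) (u j) = ((inner ℂ (u i) (u j)).re : ℂ) :=
      Complex.ext (by simp) (by simp [hGim])
    rw [h1, ← (Complex.hasSum_ofReal.2 (hG i j)).tsum_eq]
    exact tsum_congr fun a => by simp [v, mul_comm]
  have huw : ∀ a b, inner ℂ (u' a) (u' b) = inner ℂ (w a) (w b) := fun i j => by
    rw [lp.inner_eq_tsum]
    have h1 : inner ℂ (u' i) (u' j) = ((inner ℂ (u' i) (u' j)).re : ℂ) :=
      Complex.ext (by simp) (by simp [hGim'])
    rw [h1, ← (Complex.hasSum_ofReal.2 (hG' i j)).tsum_eq]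
    exact tsum_congr fun a => by simp [w, mul_comm]
  have hnv : ∀ i, ‖u i‖ = ‖v i‖ := fun i => by
    rw [@norm_eq_sqrt_re_inner ℂ, @norm_eq_sqrt_re_inner ℂ, huv]
  have hnw : ∀ a, ‖u' a‖ = ‖w a‖ := fun i => by
    rw [@norm_eq_sqrt_re_inner ℂ, @norm_eq_sqrt_re_inner ℂ, huw]
  have hv : Summable fun i => ‖v i‖ ^ 2 := by simpa only [hnv] using hu
  have hw : Summable fun i => ‖w i‖ ^ 2 := by simpa only [hnw] using hu'
  have hadj := analysisOp_adjoint_eq g v hv w hw (fun _ _ => rfl) (fun _ _ => rfl)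
  have h1 := analysisOp_comp_adjoint_congr u hu v hv huv
  have h2 := analysisOp_comp_adjoint_congr u' hu' w hw huw
  rw [tsum_rankOne_eq_adjoint_comp u hu, tsum_rankOne_eq_adjoint_comp u' hu']
  rw [vonNeumannEntropy_adjoint_comp_self, vonNeumannEntropy_adjoint_comp_self,
    maxEntropy_adjoint_comp_self, maxEntropy_adjoint_comp_self, h1, h2,
    ← hadj, ContinuousLinearMap.adjoint_adjoint]
  exact ⟨(vonNeumannEntropy_adjoint_comp_self _).symm, (maxEntropy_adjoint_comp_self _).symm⟩

end DensityComparison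

/-! ### Measurable fibres of kernels -/

/-- A finite measure on a standard Borel space is determined by its values on countably many
sets, so the fibres of a Markov kernel are measurable. -/
theorem measurableSet_kernel_eq {α β : Type*} [MeasurableSpace α] [MeasurableSpace β]
    [StandardBorelSpace β] (κ : Kernel α β) [IsMarkovKernel κ] (c : Measure β)
    [IsProbabilityMeasure c] : MeasurableSet {a | κ a = c} := by
  have he := measurableEmbedding_embeddingReal β
  have key : {a | κ a = c} = ⋂ q : ℚ, {a | κ a (embeddingReal β ⁻¹' Set.Iic (q : ℝ))
      = c (embeddingReal β ⁻¹' Set.Iic (q : ℝ))} := by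
    ext a
    simp only [Set.mem_ofPred_eq, Set.mem_iInter]
    refine ⟨fun h q => by rw [h], fun h => ?_⟩
    have hmap : (κ a).map (embeddingReal β) = c.map (embeddingReal β) := by
      have : IsProbabilityMeasure ((κ a).map (embeddingReal β)) :=
        Measure.isProbabilityMeasure_map he.measurable.aemeasurable
      have : IsProbabilityMeasure (c.map (embeddingReal β)) :=
        Measure.isProbabilityMeasure_map he.measurable.aemeasurable
      refine ext_of_generate_finite _ (((BorelSpace.measurable_eq (α := ℝ))).trans
        Real.borel_eq_generateFrom_Iic_rat) Real.isPiSystem_Iic_rat ?_ (by simp)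
      intro s hs
      obtain ⟨q, rfl⟩ := Set.mem_iUnion.1 hs
      rw [Measure.map_apply he.measurable measurableSet_Iic,
        Measure.map_apply he.measurable measurableSet_Iic, h]
    rw [← he.comap_map (κ a), hmap, he.comap_map]
  rw [key]
  exact MeasurableSet.iInter fun q =>
    measurableSet_eq_fun (κ.measurable_coe (he.measurable measurableSet_Iic)) measurable_const

/-! ### Words, cylinders and shifts -/

section Words

variable {A : Type*}

/-- The observations `X_t, X_{t+1}, …` from time `t` on. -/
def futureFrom (t : ℤ) (x : ℤ → A) : ℕ → A := fun n => x (n + t)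

/-- The cylinder of sequences that begin with the word `w`. -/
def cyl (w : List A) : Set (ℕ → A) := {f | ∀ (n : ℕ) (h : n < w.length), f n = w[n]}

/-- The sequence `w f`. -/
def prepend (w : List A) (f : ℕ → A) : ℕ → A :=
  fun n => if h : n < w.length then w[n] else f (n - w.length)

/-- The sequence `f` without its first `l` entries. -/
def dropSeq (l : ℕ) (f : ℕ → A) : ℕ → A := fun n => f (n + l)

theorem futureFrom_zero : futureFrom (A := A) 0 = future := by
  ext x n
  simp [futureFrom, future]

theorem dropSeq_future (l : ℕ) (x : ℤ → A) : dropSeq l (future x) = futureFrom l x := by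
  ext n
  simp [futureFrom, future, dropSeq]

theorem prepend_mem_cyl (w : List A) (f : ℕ → A) : prepend w f ∈ cyl w := fun n h => by
  simp [prepend, h]

theorem dropSeq_prepend (w : List A) (f : ℕ → A) : dropSeq w.length (prepend w f) = f := by
  ext n
  simp [prepend, dropSeq]

theorem prepend_dropSeq {w : List A} {f : ℕ → A} (hf : f ∈ cyl w) :
    prepend w (dropSeq w.length f) = f := by
  ext n
  by_cases h : n < w.length
  · simp [prepend, h, hf n h]
  · simp [prepend, dropSeq, h, Nat.sub_add_cancel (not_lt.1 h)]

theorem cyl_nil : cyl ([] : List A) = Set.univ := by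
  ext f
  simp [cyl]

theorem mem_cyl_singleton {x : A} {f : ℕ → A} : f ∈ cyl [x] ↔ f 0 = x := by
  simp [cyl]

theorem mem_cyl_cons {x : A} {w : List A} {f : ℕ → A} :
    f ∈ cyl (x :: w) ↔ f 0 = x ∧ dropSeq 1 f ∈ cyl w := by
  constructor
  · intro h
    refine ⟨h 0 (by simp), fun n hn => ?_⟩
    exact h (n + 1) (by simpa using hn)
  · rintro ⟨h0, h⟩ n hn
    cases n with
    | zero => exact h0
    | succ n => exact h n (by simpa using hn)

theorem prepend_cons (x : A) (w : List A) : prepend (x :: w) = prepend [x] ∘ prepend w := by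
  ext f n
  cases n with
  | zero => simp [prepend]
  | succ n => simp [prepend]

theorem prepend_nil : prepend ([] : List A) = id := by
  ext f n
  simp [prepend]

theorem cyl_disjoint {w w' : List A} (hl : w.length = w'.length) (h : w ≠ w') :
    Disjoint (cyl w) (cyl w') := by
  refine Set.disjoint_left.2 fun f hf hf' => h (List.ext_getElem hl fun n h1 h2 => ?_)
  rw [← hf n h1, hf' n h2]

theorem exists_mem_cyl (l : ℕ) (f : ℕ → A) : ∃ w : List A, w.length = l ∧ f ∈ cyl w :=
  ⟨List.ofFn fun n : Fin l => f n, by simp, fun n h => by simp⟩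

/-- At time `|w|`, after emission of `w`, the past is `w` reversed, followed by the past at
time `0`. -/
theorem pastAt_of_future_mem_cyl {w : List A} {x : ℤ → A} (h : future x ∈ cyl w) :
    pastAt w.length x = prepend w.reverse (pastAt 0 x) := by
  ext n
  by_cases hn : n < w.length
  · have h2 := h (w.length - 1 - n) (by omega)
    simp only [prepend, List.length_reverse, hn, dif_pos, List.getElem_reverse, ← h2, pastAt,
      future]
    congr 1
    omega
  · simp only [prepend, List.length_reverse, hn, dif_neg, not_false_eq_true, pastAt]
    congr 1
    omega

theorem future_mem_cyl_iff_pastAt (w : List A) (x : ℤ → A) :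
    future x ∈ cyl w ↔ pastAt w.length x ∈ cyl w.reverse := by
  refine ⟨fun h => ?_, fun h n hn => ?_⟩
  · rw [pastAt_of_future_mem_cyl h]
    exact prepend_mem_cyl _ _
  · have h2 := h (w.length - 1 - n) (by simp; omega)
    have h3 : ((w.length : ℤ) - 1 - (w.length - 1 - n : ℕ)) = n := by omega
    simp only [pastAt, List.getElem_reverse, h3] at h2
    rw [future, h2]
    congr 1
    omega

variable [MeasurableSpace A]

@[fun_prop] theorem measurable_pastAt (t : ℤ) : Measurable (pastAt (A := A) t) :=
  measurable_pi_lambda _ fun _ => measurable_pi_apply _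

@[fun_prop] theorem measurable_futureFrom (t : ℤ) : Measurable (futureFrom (A := A) t) :=
  measurable_pi_lambda _ fun _ => measurable_pi_apply _

@[fun_prop] theorem measurable_future : Measurable (future (A := A)) :=
  measurable_pi_lambda _ fun _ => measurable_pi_apply _

@[fun_prop] theorem measurable_dropSeq (l : ℕ) : Measurable (dropSeq (A := A) l) :=
  measurable_pi_lambda _ fun _ => measurable_pi_apply _

@[fun_prop] theorem measurable_prepend (w : List A) : Measurable (prepend w) := by
  refine measurable_pi_lambda _ fun n => ?_
  by_cases h : n < w.length
  · simp [prepend, h]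
  · simpa [prepend, h] using measurable_pi_apply _

theorem measurableSet_cyl [MeasurableSingletonClass A] (w : List A) : MeasurableSet (cyl w) := by
  have : cyl w = ⋂ n : Fin w.length, {f | f n = w[n]} := by
    ext f
    simp [cyl, Fin.forall_iff]
  rw [this]
  exact MeasurableSet.iInter fun n => measurable_pi_apply _ (measurableSet_singleton _)

/-- Under a stationary law, past and future at time `t` are distributed as at time `0`. -/
theorem IsStationary.map_past_future {μ : Measure (ℤ → A)} (hμ : IsStationary μ) (t u : ℤ) :
    μ.map (fun x => (pastAt t x, futureFrom (u + t) x))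
      = μ.map (fun x => (pastAt 0 x, futureFrom u x)) := by
  conv_rhs => rw [← hμ t]
  have hθ : Measurable fun (x : ℤ → A) s => x (s + t) :=
    measurable_pi_lambda _ fun _ => measurable_pi_apply _
  have hpair : Measurable fun x : ℤ → A => (pastAt 0 x, futureFrom u x) := by fun_prop
  rw [Measure.map_map hpair hθ]
  congr 1
  ext x n
  · simp only [pastAt, Function.comp_apply]
    congr 1
    ring
  · simp only [futureFrom, Function.comp_apply]
    congr 1
    ring

theorem IsStationary.measure_past_future {μ : Measure (ℤ → A)} (hμ : IsStationary μ)
    (t : ℤ) {D B : Set (ℕ → A)} (hD : MeasurableSet D) (hB : MeasurableSet B) :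
    μ (pastAt t ⁻¹' D ∩ futureFrom t ⁻¹' B) = μ (pastAt 0 ⁻¹' D ∩ future ⁻¹' B) := by
  have h := congrArg (fun m => m (D ×ˢ B)) (hμ.map_past_future t 0)
  have hD' := hD.prod hB
  simp only [zero_add, futureFrom_zero] at h
  rwa [Measure.map_apply (by fun_prop) hD', Measure.map_apply (by fun_prop) hD'] at h

theorem IsStationary.measure_past {μ : Measure (ℤ → A)} (hμ : IsStationary μ)
    (t : ℤ) {D : Set (ℕ → A)} (hD : MeasurableSet D) : μ (pastAt t ⁻¹' D) = μ (pastAt 0 ⁻¹' D) := by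
  simpa using hμ.measure_past_future t hD MeasurableSet.univ

theorem integrable_indicator_one {μ : Measure (ℤ → A)} [IsFiniteMeasure μ]
    {s : Set (ℤ → A)} (hs : MeasurableSet s) :
    Integrable (s.indicator fun _ => (1 : ℝ)) μ :=
  (integrable_const _).indicator hs

theorem comap_future_le :
    MeasurableSpace.comap (future (A := A)) inferInstance ≤ MeasurableSpace.pi :=
  measurable_future.comap_le

end Words

/-! ### Causal states and unifilarity -/

section Unifilar

variable {A : Type*} [Countable A] [Nonempty A] [MeasurableSpace A] [DiscreteMeasurableSpace A]
variable (μ : Measure (ℤ → A)) [IsProbabilityMeasure μ]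

instance : IsMarkovKernel (futureLaw μ) := by unfold futureLaw; infer_instance

/-- The conditional law of the future in a causal state. -/
def stateLaw (i : CausalState μ) : Measure (ℕ → A) := futureLaw μ i.1.out

instance (i : CausalState μ) : IsProbabilityMeasure (stateLaw μ i) := by
  unfold stateLaw; infer_instance

/-- The pasts that lead to the causal state `i`. -/
def statePasts (i : CausalState μ) : Set (ℕ → A) := {p | futureLaw μ p = stateLaw μ i}

variable {μ}

theorem causalClass_eq_iff (p : ℕ → A) (i : CausalState μ) :
    causalClass μ p = i.1 ↔ p ∈ statePasts μ i := by
  have h : causalClass μ i.1.out = i.1 := Quotient.out_eq _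
  rw [← h]
  exact Quotient.eq (r := causalSetoid μ)

theorem stateEvent_eq (t : ℤ) (i : CausalState μ) :
    stateEvent μ t i.1 = pastAt t ⁻¹' statePasts μ i := by
  ext x
  exact causalClass_eq_iff _ _

theorem measurableSet_statePasts (i : CausalState μ) : MeasurableSet (statePasts μ i) :=
  measurableSet_kernel_eq _ _

theorem measurableSet_stateEvent (t : ℤ) (i : CausalState μ) :
    MeasurableSet (stateEvent μ t i.1) := by
  rw [stateEvent_eq]
  exact measurable_pastAt t (measurableSet_statePasts i)

/-- Equivalent pasts are those with the same conditional law, so a causal state is determined by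
its law. -/
theorem stateLaw_injective : Function.Injective (stateLaw μ) := fun i j h => by
  have hi : i.1.out ∈ statePasts μ i := rfl
  have hj : i.1.out ∈ statePasts μ j := h
  rw [← causalClass_eq_iff] at hi hj
  exact Subtype.ext (hi.symm.trans hj)

theorem pairwise_disjoint_stateEvent (t : ℤ) :
    Pairwise (Function.onFun Disjoint fun i : CausalState μ => stateEvent μ t i.1) :=
  fun _ _ hij => Set.disjoint_left.2 fun _ hi hj => hij (Subtype.ext (hi.symm.trans hj))

instance : Countable (CausalState μ) := by
  have h := Measure.countable_meas_pos_of_disjoint_iUnion (μ := μ)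
    (fun i => measurableSet_stateEvent 0 i) (pairwise_disjoint_stateEvent (μ := μ) 0)
  have hu : {i : CausalState μ | 0 < μ (stateEvent μ 0 i.1)} = Set.univ :=
    Set.eq_univ_of_forall fun i => pos_iff_ne_zero.2 i.2
  rw [hu] at h
  exact Set.countable_univ_iff.1 h

theorem stateProb_pos (i : CausalState μ) : 0 < stateProb μ i :=
  ENNReal.toReal_pos i.2 (measure_ne_top _ _)

/-- In a causal state the future is independent of the past. -/
theorem measure_state_past_future (i : CausalState μ) {D B : Set (ℕ → A)}
    (hD : MeasurableSet D) (hB : MeasurableSet B) :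
    μ (pastAt 0 ⁻¹' (statePasts μ i ∩ D) ∩ future ⁻¹' B)
      = μ (pastAt 0 ⁻¹' (statePasts μ i ∩ D)) * stateLaw μ i B := by
  have hS := (measurableSet_statePasts i).inter hD
  rw [← setLIntegral_preimage_condDistrib (measurable_pastAt 0) (by fun_prop) hB hS]
  rw [setLIntegral_congr_fun (g := fun _ => stateLaw μ i B) (measurable_pastAt 0 hS)]
  · rw [setLIntegral_const, mul_comm]
  · intro x hx
    have h : futureLaw μ (pastAt 0 x) = stateLaw μ i := hx.1
    rw [← h]
    rfl

theorem measure_state_future (i : CausalState μ) {B : Set (ℕ → A)} (hB : MeasurableSet B) :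
    μ (stateEvent μ 0 i.1 ∩ future ⁻¹' B) = μ (stateEvent μ 0 i.1) * stateLaw μ i B := by
  simpa [stateEvent_eq] using measure_state_past_future i MeasurableSet.univ hB

/-- If the future is independent of the past given an event `G` in the past, then on `G` the
conditional law of the future is almost surely constant. -/
theorem ae_futureLaw_eq {G : Set (ℕ → A)} (hG : MeasurableSet G) (c : Measure (ℕ → A))
    [IsFiniteMeasure c]
    (h : ∀ D B, MeasurableSet D → MeasurableSet B →
      μ (pastAt 0 ⁻¹' (G ∩ D) ∩ future ⁻¹' B) = μ (pastAt 0 ⁻¹' (G ∩ D)) * c B) :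
    ∀ᵐ x ∂μ, pastAt 0 x ∈ G → futureLaw μ (pastAt 0 x) = c := by
  have key : ((μ.map (pastAt 0)).restrict G) ⊗ₘ futureLaw μ
      = ((μ.map (pastAt 0)).restrict G) ⊗ₘ Kernel.const _ c := by
    rw [Measure.compProd_const]
    refine (Measure.prod_eq fun D B hD hB => ?_).symm
    rw [Measure.compProd_apply_prod hD hB, Measure.restrict_restrict hD,
      Measure.restrict_apply hD, Set.inter_comm D G,
      setLIntegral_map (hG.inter hD) ((futureLaw μ).measurable_coe hB) (measurable_pastAt 0),
      Measure.map_apply (measurable_pastAt 0) (hG.inter hD), ← h D B hD hB]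
    exact setLIntegral_preimage_condDistrib (measurable_pastAt 0) (by fun_prop) hB (hG.inter hD)
  have h2 := Kernel.ae_eq_of_compProd_eq key
  have h3 := (ae_restrict_iff' hG).1 h2
  simpa using ae_of_ae_map (measurable_pastAt 0).aemeasurable h3

/-- In the causal state `i`, emission of the word `w` has positive probability and leads to the
state `k`: given the word, what follows it has the law attached to `k`. -/
def Leads (i : CausalState μ) (w : List A) (k : CausalState μ) : Prop :=
  stateLaw μ i (cyl w) ≠ 0 ∧
    (stateLaw μ i).restrict (cyl w) = stateLaw μ i (cyl w) • (stateLaw μ k).map (prepend w)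

theorem Leads.unique {i k k' : CausalState μ} {w : List A} (h : Leads i w k) (h' : Leads i w k') :
    k = k' := by
  refine stateLaw_injective ?_
  have h2 := congrArg (Measure.map (dropSeq w.length)) (h.2.symm.trans h'.2)
  have hid : dropSeq w.length ∘ prepend w = (id : (ℕ → A) → (ℕ → A)) :=
    funext (dropSeq_prepend w)
  simp only [Measure.map_smul, Measure.map_map (measurable_dropSeq _) (measurable_prepend w), hid,
    Measure.map_id] at h2
  ext B -
  have h3 := congrArg (fun m => m B) h2
  simpa [ENNReal.mul_right_inj h.1 (measure_ne_top _ _)] using h3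

theorem leads_nil {i k : CausalState μ} : Leads i [] k ↔ k = i := by
  have h : Leads i [] i := ⟨by simp [cyl_nil], by simp [cyl_nil, prepend_nil]⟩
  exact ⟨fun h' => h'.unique h, fun h' => h' ▸ h⟩

theorem Leads.apply_inter {i k : CausalState μ} {w : List A} (h : Leads i w k) {B : Set (ℕ → A)}
    (hB : MeasurableSet B) :
    stateLaw μ i (B ∩ cyl w) = stateLaw μ i (cyl w) * stateLaw μ k (prepend w ⁻¹' B) := by
  have := congrArg (fun m => m B) h.2
  simpa [Measure.restrict_apply hB, Measure.map_apply (measurable_prepend w) hB] using this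

/-- Unifilarity: if the word `w` has positive probability in the state `i`, then its emission
leads almost surely to a definite causal state. -/
theorem exists_leads (hμ : IsStationary μ) {i : CausalState μ} {w : List A}
    (hw : stateLaw μ i (cyl w) ≠ 0) :
    ∃ k, Leads i w k ∧ ∀ᵐ x ∂μ, x ∈ stateEvent μ 0 i.1 → future x ∈ cyl w →
      x ∈ stateEvent μ w.length k.1 := by
  set κ := stateLaw μ i with hκ
  set l := w.length with hl
  -- the conditional law, in the state `i`, of what follows `w`
  let c : Measure (ℕ → A) := (κ (cyl w))⁻¹ • (κ.restrict (cyl w)).map (dropSeq l)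
  have hwt : κ (cyl w) ≠ ∞ := measure_ne_top _ _
  have hc : ∀ {B}, MeasurableSet B → κ (cyl w) * c B = κ (cyl w ∩ dropSeq l ⁻¹' B) := by
    intro B hB
    simp only [c, Measure.smul_apply, smul_eq_mul, ← mul_assoc, ENNReal.mul_inv_cancel hw hwt,
      one_mul]
    rw [Measure.map_apply (measurable_dropSeq l) hB,
      Measure.restrict_apply (measurable_dropSeq l hB), Set.inter_comm]
  have hcprob : IsProbabilityMeasure c := ⟨by
    have := hc MeasurableSet.univ
    simpa [ENNReal.mul_eq_left hw hwt] using this⟩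
  -- the pasts at time `l` that pass through `i` and then `w`
  let G : Set (ℕ → A) := {p | dropSeq l p ∈ statePasts μ i ∧ p ∈ cyl w.reverse}
  have hGm : MeasurableSet G :=
    (measurable_dropSeq l (measurableSet_statePasts i)).inter (measurableSet_cyl _)
  have hdrop : ∀ x : ℤ → A, dropSeq l (pastAt l x) = pastAt 0 x := fun x => by
    ext n
    simp only [dropSeq, pastAt]
    congr 1
    push_cast
    ring
  have hGiff : ∀ x : ℤ → A, pastAt l x ∈ G ↔ x ∈ stateEvent μ 0 i.1 ∧ future x ∈ cyl w := by
    intro x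
    rw [stateEvent_eq, future_mem_cyl_iff_pastAt]
    simp only [G, Set.mem_ofPred_eq, hdrop, Set.mem_preimage, ← hl]
  have hGD : ∀ D, pastAt (l : ℤ) ⁻¹' (G ∩ D) = pastAt 0 ⁻¹' (statePasts μ i ∩
      prepend w.reverse ⁻¹' D) ∩ future ⁻¹' cyl w := by
    intro D
    ext x
    have h1 := hGiff x
    rw [stateEvent_eq] at h1
    simp only [Set.mem_preimage, Set.mem_inter_iff] at h1 ⊢
    constructor
    · rintro ⟨hg, hd⟩
      obtain ⟨h2, h3⟩ := h1.1 hg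
      rw [pastAt_of_future_mem_cyl h3] at hd
      exact ⟨⟨h2, hd⟩, h3⟩
    · rintro ⟨⟨h2, hd⟩, h3⟩
      refine ⟨h1.2 ⟨h2, h3⟩, ?_⟩
      rwa [pastAt_of_future_mem_cyl h3]
  -- given `G`, the future at time `l` has the law `c` independently of the past at time `l`
  have hae := ae_futureLaw_eq hGm c (μ := μ) (by
    intro D B hD hB
    have hD' := measurable_prepend w.reverse hD
    rw [← hμ.measure_past_future l (hGm.inter hD) hB, ← hμ.measure_past l (hGm.inter hD), hGD D,
      measure_state_past_future i hD' (measurableSet_cyl w), mul_assoc, ← hκ, hc hB]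
    have hset : pastAt 0 ⁻¹' (statePasts μ i ∩ prepend w.reverse ⁻¹' D) ∩ future ⁻¹' cyl w
        ∩ futureFrom l ⁻¹' B = pastAt 0 ⁻¹' (statePasts μ i ∩ prepend w.reverse ⁻¹' D)
        ∩ future ⁻¹' (cyl w ∩ dropSeq l ⁻¹' B) := by
      ext x
      simp only [Set.mem_inter_iff, Set.mem_preimage, dropSeq_future]
      tauto
    rw [hset, measure_state_past_future i hD'
      ((measurableSet_cyl w).inter (measurable_dropSeq l hB))])
  -- `G` has the probability `π_i P(w | i)`, and almost all of it lies in a single causal class,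
  -- which therefore is a causal state
  have hGpos : μ (pastAt 0 ⁻¹' G) ≠ 0 := by
    have h1 := hGD Set.univ
    simp only [Set.inter_univ, Set.preimage_univ] at h1
    rw [← hμ.measure_past l hGm, h1, ← stateEvent_eq, measure_state_future i (measurableSet_cyl w)]
    exact mul_ne_zero i.2 hw
  obtain ⟨x₀, hx₀G, hx₀⟩ : ∃ x, pastAt 0 x ∈ G ∧ futureLaw μ (pastAt 0 x) = c := by
    by_contra! hne
    refine hGpos (measure_mono_null (fun x hx => ?_) hae)
    exact fun h => hne x hx (h hx)
  have hkpos : μ (stateEvent μ 0 (causalClass μ (pastAt 0 x₀))) ≠ 0 := by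
    refine fun h0 => hGpos (le_antisymm (le_trans (measure_mono_ae ?_) h0.le) bot_le)
    filter_upwards [hae] with x hx hxG
    exact Quotient.sound (s := causalSetoid μ) ((hx hxG).trans hx₀.symm)
  let k : CausalState μ := ⟨_, hkpos⟩
  have hkc : stateLaw μ k = c := by
    rw [← hx₀]
    exact ((causalClass_eq_iff (pastAt 0 x₀) k).1 rfl).symm
  refine ⟨k, ⟨hw, ?_⟩, ?_⟩
  · rw [hkc]
    ext B hB
    rw [Measure.smul_apply, smul_eq_mul, Measure.map_apply (measurable_prepend w) hB,
      hc (measurable_prepend w hB), Measure.restrict_apply hB]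
    congr 1
    ext f
    simp only [Set.mem_inter_iff, Set.mem_preimage]
    constructor
    · rintro ⟨h1, h2⟩
      exact ⟨h2, by rwa [hl, prepend_dropSeq h2]⟩
    · rintro ⟨h1, h2⟩
      exact ⟨by rwa [hl, prepend_dropSeq h1] at h2, h1⟩
  · have hGk : MeasurableSet (G \ statePasts μ k) := hGm.diff (measurableSet_statePasts k)
    have hnull : μ (pastAt (l : ℤ) ⁻¹' (G \ statePasts μ k)) = 0 := by
      rw [hμ.measure_past l hGk]
      refine measure_mono_null (fun x hx => ?_) hae
      intro h
      exact hx.2 ((h hx.1).trans hkc.symm)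
    filter_upwards [measure_eq_zero_iff_ae_notMem.1 hnull] with x hx h1 h2
    rw [stateEvent_eq]
    by_contra h3
    exact hx ⟨(hGiff x).2 ⟨h1, h2⟩, h3⟩

theorem Leads.ae_mem (hμ : IsStationary μ) {i k : CausalState μ} {w : List A} (h : Leads i w k) :
    ∀ᵐ x ∂μ, x ∈ stateEvent μ 0 i.1 → future x ∈ cyl w → x ∈ stateEvent μ w.length k.1 := by
  obtain ⟨k', hk', hae⟩ := exists_leads hμ h.1
  rwa [h.unique hk']

theorem stateLaw_cyl_cons {i j : CausalState μ} {x : A} (h : Leads i [x] j) (w : List A) :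
    stateLaw μ i (cyl (x :: w)) = stateLaw μ i (cyl [x]) * stateLaw μ j (cyl w) := by
  have h1 := h.apply_inter (measurableSet_cyl (x :: w))
  have h2 : cyl (x :: w) ∩ cyl [x] = cyl (x :: w) := Set.inter_eq_left.2 fun f hf =>
    mem_cyl_singleton.2 (mem_cyl_cons.1 hf).1
  have h3 : prepend [x] ⁻¹' cyl (x :: w) = cyl w := by
    ext f
    have h4 := dropSeq_prepend [x] f
    simp only [List.length_singleton] at h4
    rw [Set.mem_preimage, mem_cyl_cons, h4]
    simp [prepend]
  rwa [h2, h3] at h1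

theorem Leads.cons_of {i j k : CausalState μ} {x : A} {w : List A} (h : Leads i [x] j)
    (h' : Leads j w k) : Leads i (x :: w) k := by
  have hcons := stateLaw_cyl_cons h w
  refine ⟨by rw [hcons]; exact mul_ne_zero h.1 h'.1, ?_⟩
  ext B hB
  have h2 : B ∩ cyl (x :: w) = (B ∩ cyl (x :: w)) ∩ cyl [x] := (Set.inter_eq_left.2 fun f hf =>
    mem_cyl_singleton.2 (mem_cyl_cons.1 hf.2).1).symm
  have h3 : prepend [x] ⁻¹' (B ∩ cyl (x :: w)) = prepend [x] ⁻¹' B ∩ cyl w := by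
    ext f
    have h4 := dropSeq_prepend [x] f
    simp only [List.length_singleton] at h4
    rw [Set.mem_preimage, Set.mem_inter_iff, mem_cyl_cons, h4]
    simp [prepend]
  rw [Measure.restrict_apply hB, h2, h.apply_inter (hB.inter (measurableSet_cyl _)), h3,
    h'.apply_inter (measurable_prepend [x] hB), Measure.smul_apply, smul_eq_mul, hcons,
    Measure.map_apply (measurable_prepend _) hB, prepend_cons x w, mul_assoc, Set.preimage_comp]

theorem leads_cons_iff (hμ : IsStationary μ) {i j k : CausalState μ} {x : A} {w : List A}
    (h : Leads i [x] j) : Leads i (x :: w) k ↔ Leads j w k := by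
  refine ⟨fun h' => ?_, h.cons_of⟩
  have hj : stateLaw μ j (cyl w) ≠ 0 := by
    have := h'.1
    rw [stateLaw_cyl_cons h w] at this
    exact right_ne_zero_of_mul this
  obtain ⟨k', hk', -⟩ := exists_leads hμ hj
  rwa [h'.unique (h.cons_of hk')]

theorem Leads.exists_head (hμ : IsStationary μ) {i k : CausalState μ} {x : A} {w : List A}
    (h : Leads i (x :: w) k) : ∃ j, Leads i [x] j := by
  have h1 : stateLaw μ i (cyl [x]) ≠ 0 := fun h0 => h.1 <|
    measure_mono_null (fun f hf => mem_cyl_singleton.2 (mem_cyl_cons.1 hf).1) h0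
  obtain ⟨j, hj, -⟩ := exists_leads hμ h1
  exact ⟨j, hj⟩

theorem transProb_eq_inter (x : A) (i j : CausalState μ) :
    transProb μ x i j = (μ (stateEvent μ 0 i.1)).toReal⁻¹ *
      μ.real (stateEvent μ 0 i.1 ∩ future ⁻¹' cyl [x] ∩ stateEvent μ 1 j.1) := by
  have hset : {ω : ℤ → A | ω 0 = x} = future ⁻¹' cyl [x] := by
    ext ω
    simp [mem_cyl_singleton, future]
  rw [transProb, hset, measureReal_def, cond_apply (measurableSet_stateEvent 0 i),
    ENNReal.toReal_mul, ENNReal.toReal_inv, Set.inter_assoc]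
  rfl

theorem transProb_of_leads (hμ : IsStationary μ) {x : A} {i j : CausalState μ}
    (h : Leads i [x] j) : transProb μ x i j = (stateLaw μ i).real (cyl [x]) := by
  have h1 : μ (stateEvent μ 0 i.1 ∩ future ⁻¹' cyl [x] ∩ stateEvent μ 1 j.1)
      = μ (stateEvent μ 0 i.1 ∩ future ⁻¹' cyl [x]) := by
    refine measure_congr ?_
    filter_upwards [h.ae_mem hμ] with ω hω
    refine propext ⟨fun h => h.1, fun h => ⟨h, ?_⟩⟩
    simpa using hω h.1 h.2
  have hne : (μ (stateEvent μ 0 i.1)).toReal ≠ 0 := (stateProb_pos i).ne'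
  rw [transProb_eq_inter, measureReal_def, h1, measure_state_future i (measurableSet_cyl _),
    ENNReal.toReal_mul, inv_mul_cancel_left₀ hne, measureReal_def]

theorem transProb_of_not_leads (hμ : IsStationary μ) {x : A} {i j : CausalState μ}
    (h : ¬ Leads i [x] j) : transProb μ x i j = 0 := by
  rw [transProb_eq_inter]
  refine mul_eq_zero_of_right _ ?_
  rw [measureReal_eq_zero_iff]
  by_cases hx : stateLaw μ i (cyl [x]) = 0
  · refine measure_mono_null Set.inter_subset_left ?_
    rw [measure_state_future i (measurableSet_cyl _), hx, mul_zero]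
  · obtain ⟨k, hk, hae⟩ := exists_leads hμ hx
    have hkj : k ≠ j := fun hkj => h (hkj ▸ hk)
    rw [measure_eq_zero_iff_ae_notMem]
    filter_upwards [hae] with ω hω hmem
    have hk' := hω hmem.1.1 hmem.1.2
    exact Set.disjoint_left.1 (pairwise_disjoint_stateEvent (μ := μ) 1 hkj) (by simpa using hk')
      hmem.2

end Unifilar

/-! ### Amplitudes of the vectors `|S_i(l)⟩` -/

theorem hasSum_measureReal_iUnion {α ι : Type*} [Countable ι] {_ : MeasurableSpace α}
    (ν : Measure α) [IsFiniteMeasure ν] {s : ι → Set α} (hs : ∀ i, MeasurableSet (s i))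
    (hd : Pairwise (Function.onFun Disjoint s)) :
    HasSum (fun i => ν.real (s i)) (ν.real (⋃ i, s i)) := by
  simpa using hasSum_integral_iUnion (f := fun _ => (1 : ℝ)) (μ := ν) hs hd
    (integrable_const _).integrableOn

section Amplitudes

variable {A : Type*} [Countable A] [Nonempty A] [MeasurableSpace A] [DiscreteMeasurableSpace A]
variable {μ : Measure (ℤ → A)} [IsProbabilityMeasure μ]

theorem norm_ketCons (x : A) (v : QSpace μ) : ‖ketCons x v‖ = ‖v‖ := by
  have h1 := lp.norm_rpow_eq_tsum (p := 2) (by norm_num) (ketCons x v)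
  have h2 := lp.norm_rpow_eq_tsum (p := 2) (by norm_num) v
  simp only [ENNReal.toReal_ofNat, Real.rpow_ofNat] at h1 h2
  have he : Function.Injective fun c : List A × CausalState μ => (x :: c.1, c.2) := by
    rintro ⟨w, j⟩ ⟨w', j'⟩ h
    simpa using h
  have h3 : ∑' c, ‖ketCons x v c‖ ^ 2 = ∑' c, ‖v c‖ ^ 2 := by
    rw [← he.tsum_eq]
    · exact tsum_congr fun c => by simp [ketCons, ketConsFun]
    · rintro ⟨w, j⟩ hc
      cases w with
      | nil => simp [ketCons, ketConsFun] at hc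
      | cons y w =>
        by_cases hy : y = x
        · exact ⟨(w, j), by simp [hy]⟩
        · simp [ketCons, ketConsFun, hy] at hc
  rw [← h2, ← h1] at h3
  exact (sq_eq_sq₀ (norm_nonneg _) (norm_nonneg _)).1 h3

theorem inner_ketCons_of_ne {x y : A} (hxy : x ≠ y) (v v' : QSpace μ) :
    inner ℂ (ketCons x v) (ketCons y v') = 0 := by
  rw [lp.inner_eq_tsum]
  refine (tsum_congr fun c => ?_).trans tsum_zero
  obtain ⟨w, j⟩ := c
  cases w with
  | nil => simp [ketCons, ketConsFun]
  | cons z w =>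
    by_cases hz : z = x
    · simp [ketCons, ketConsFun, hz, hxy]
    · simp [ketCons, ketConsFun, hz]

open Classical in
/-- The cylinder of `w` if the word `w` of length `l` leads from both `i` and `j` to the state `k`,
and the empty set otherwise. -/
def mergeCyl (l : ℕ) (i j : CausalState μ) (c : List A × CausalState μ) : Set (ℕ → A) :=
  if c.1.length = l ∧ Leads i c.1 c.2 ∧ Leads j c.1 c.2 then cyl c.1 else ∅

/-- The futures whose first `l` symbols synchronize the states `i` and `j`. -/
def mergeSet (l : ℕ) (i j : CausalState μ) : Set (ℕ → A) := ⋃ c, mergeCyl l i j c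

theorem measurableSet_mergeCyl (l : ℕ) (i j : CausalState μ) (c : List A × CausalState μ) :
    MeasurableSet (mergeCyl l i j c) := by
  unfold mergeCyl
  split_ifs
  · exact measurableSet_cyl _
  · exact MeasurableSet.empty

theorem measurableSet_mergeSet (l : ℕ) (i j : CausalState μ) :
    MeasurableSet (mergeSet l i j) :=
  MeasurableSet.iUnion fun c => measurableSet_mergeCyl l i j c

theorem pairwise_disjoint_mergeCyl (l : ℕ) (i j : CausalState μ) :
    Pairwise (Function.onFun Disjoint (mergeCyl l i j)) := by
  rintro ⟨w, k⟩ ⟨w', k'⟩ hne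
  simp only [Function.onFun, mergeCyl]
  split_ifs with h h'
  · refine cyl_disjoint (h.1.trans h'.1.symm) fun hw => hne ?_
    subst hw
    rw [h.2.1.unique h'.2.1]
  all_goals simp

open Classical in
/-- `v` has the amplitude `√P(w | S_0 = i)` at `|w⟩|k⟩` if the word `w` of length `l` leads from
`i` to `k`, and no other nonzero amplitudes. -/
def HasAmplitudes (l : ℕ) (i : CausalState μ) (v : QSpace μ) : Prop :=
  ∀ w k, v (w, k) =
    if w.length = l ∧ Leads i w k then (Real.sqrt ((stateLaw μ i).real (cyl w)) : ℂ) else 0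

theorem HasAmplitudes.norm_sq_le {l : ℕ} {i : CausalState μ} {v : QSpace μ}
    (h : HasAmplitudes l i v) : ‖v‖ ^ 2 ≤ 1 := by
  have h1 := lp.norm_rpow_eq_tsum (p := 2) (by norm_num) v
  simp only [ENNReal.toReal_ofNat, Real.rpow_ofNat] at h1
  have h2 : ∑' c, ‖v c‖ ^ 2 = ∑' c, (stateLaw μ i).real (mergeCyl l i i c) := by
    refine tsum_congr fun c => ?_
    obtain ⟨w, k⟩ := c
    rw [h w k]
    unfold mergeCyl
    by_cases hw : w.length = l ∧ Leads i w k
    · simp [hw]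
    · simp [hw]
  rw [h1, h2, (hasSum_measureReal_iUnion (stateLaw μ i) (measurableSet_mergeCyl l i i)
    (pairwise_disjoint_mergeCyl l i i)).tsum_eq]
  exact measureReal_le_one

theorem transProb_nonneg (x : A) (i j : CausalState μ) : 0 ≤ transProb μ x i j :=
  measureReal_nonneg

theorem summable_transProb (i : CausalState μ) :
    Summable fun c : A × CausalState μ => transProb μ c.1 i c.2 := by
  refine (hasSum_measureReal_iUnion (cond μ (stateEvent μ 0 i.1))
    (s := fun c : A × CausalState μ => {ω | ω 0 = c.1} ∩ stateEvent μ 1 c.2.1) ?_ ?_).summable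
  · intro c
    exact (measurable_pi_apply 0 (measurableSet_singleton c.1)).inter
      (measurableSet_stateEvent 1 c.2)
  · rintro ⟨x, j⟩ ⟨y, k⟩ hne
    refine Set.disjoint_left.2 fun ω h1 h2 => hne ?_
    have hx : x = y := h1.1.symm.trans h2.1
    have hj : j = k := Subtype.ext (h1.2.symm.trans h2.2)
    rw [hx, hj]

/-- By unifilarity the terms of the sum that defines `|S_i(l+1)⟩` are pairwise orthogonal. -/
theorem hasSum_qState_succ (hμ : IsStationary μ) {l : ℕ}
    (hl : ∀ j, HasAmplitudes l j (qState μ l j)) (i : CausalState μ) :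
    HasSum (fun c : A × CausalState μ =>
      (Real.sqrt (transProb μ c.1 i c.2) : ℂ) • ketCons c.1 (qState μ l c.2))
      (qState μ (l + 1) i) := by
  set f : A × CausalState μ → QSpace μ := fun c =>
    (Real.sqrt (transProb μ c.1 i c.2) : ℂ) • ketCons c.1 (qState μ l c.2) with hf
  refine Summable.hasSum ?_
  -- distinct symbols give orthogonal vectors, and each symbol leads to one state only
  have horth : ∀ c c', c ≠ c' → inner ℂ (f c) (f c') = 0 := by
    rintro ⟨x, j⟩ ⟨y, k⟩ hne
    simp only [hf, inner_smul_left, inner_smul_right]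
    by_cases hxy : x = y
    · subst hxy
      by_cases hj : Leads i [x] j
      · have hk : ¬ Leads i [x] k := fun hk => hne (by rw [hj.unique hk])
        simp [transProb_of_not_leads hμ hk]
      · simp [transProb_of_not_leads hμ hj]
    · simp [inner_ketCons_of_ne hxy]
  have hfam : OrthogonalFamily ℂ (fun c => (Submodule.span ℂ {f c} : Submodule ℂ (QSpace μ)))
      fun c => (Submodule.span ℂ {f c}).subtypeₗᵢ := by
    rintro c c' hne ⟨v, hv⟩ ⟨v', hv'⟩
    obtain ⟨a, rfl⟩ := Submodule.mem_span_singleton.1 hv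
    obtain ⟨b, rfl⟩ := Submodule.mem_span_singleton.1 hv'
    simp [inner_smul_left, inner_smul_right, horth c c' hne]
  have h1 := hfam.summable_iff_norm_sq_summable
    fun c => ⟨f c, Submodule.mem_span_singleton_self (f c)⟩
  refine h1.2 ((summable_transProb i).of_nonneg_of_le (fun c => by positivity) fun c => ?_)
  have hn : ‖f c‖ ^ 2 = transProb μ c.1 i c.2 * ‖qState μ l c.2‖ ^ 2 := by
    simp only [hf, norm_smul, norm_ketCons, mul_pow, Complex.norm_real, Real.norm_eq_abs, sq_abs]
    rw [Real.sq_sqrt (transProb_nonneg _ _ _)]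
  refine hn.le.trans ?_
  exact mul_le_of_le_one_right (transProb_nonneg _ _ _) (hl c.2).norm_sq_le

theorem qState_hasAmplitudes (hμ : IsStationary μ) (l : ℕ) :
    ∀ i : CausalState μ, HasAmplitudes l i (qState μ l i) := by
  classical
  induction l with
  | zero =>
    intro i w k
    rw [qState]
    by_cases hw : w = []
    · subst hw
      by_cases hk : k = i
      · subst hk
        simp [leads_nil, cyl_nil]
      · simp [leads_nil, hk, lp.single_apply]
    · simp [hw, lp.single_apply]
  | succ l ih =>
    intro i w k
    have hsum := (hasSum_qState_succ hμ ih i).mapL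
      (innerSL ℂ (lp.single 2 (w, k) (1 : ℂ) : QSpace μ))
    simp only [innerSL_apply_apply, lp.inner_single_left] at hsum
    have hval : qState μ (l + 1) i (w, k) = ∑' c : A × CausalState μ,
        (Real.sqrt (transProb μ c.1 i c.2) : ℂ) * ketConsFun c.1 (qState μ l c.2) (w, k) := by
      refine Eq.trans ?_ (hsum.tsum_eq.symm.trans (tsum_congr fun c => ?_))
      · simp
      · change inner ℂ (1 : ℂ) ((Real.sqrt (transProb μ c.1 i c.2) : ℂ) *
          ketConsFun c.1 (qState μ l c.2) (w, k)) = _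
        simp
    rw [hval]
    cases w with
    | nil => simp [ketConsFun]
    | cons x w =>
      by_cases hx : ∃ j, Leads i [x] j
      · obtain ⟨j, hj⟩ := hx
        rw [tsum_eq_single (x, j)]
        · simp only [ketConsFun, if_true, ih j w k, leads_cons_iff hμ hj, List.length_cons,
            add_left_inj, transProb_of_leads hμ hj, mul_ite, mul_zero]
          refine if_congr Iff.rfl ?_ rfl
          rw [← Complex.ofReal_mul, ← Real.sqrt_mul measureReal_nonneg, measureReal_def,
            measureReal_def, measureReal_def, stateLaw_cyl_cons hj w, ENNReal.toReal_mul]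
        · rintro ⟨y, j'⟩ hne
          by_cases hy : x = y
          · subst hy
            have hj' : ¬ Leads i [x] j' := fun hj' => hne (by rw [hj.unique hj'])
            simp [transProb_of_not_leads hμ hj']
          · simp [ketConsFun, hy]
      · have h1 : ¬ Leads i (x :: w) k := fun h => hx (h.exists_head hμ)
        rw [if_neg fun h => h1 h.2]
        refine (tsum_congr fun c => ?_).trans tsum_zero
        obtain ⟨y, j⟩ := c
        by_cases hy : x = y
        · subst hy
          simp [transProb_of_not_leads hμ fun h => hx ⟨j, h⟩]
        · simp [ketConsFun, hy]

end Amplitudes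

/-! ### Posterior probabilities of the causal states -/

section Posterior

variable {A : Type*} [Countable A] [Nonempty A] [MeasurableSpace A] [DiscreteMeasurableSpace A]
variable {μ : Measure (ℤ → A)} [IsProbabilityMeasure μ]

/-- `P(S_l = i | X_{0:∞})`, the probability of the state `i` at time `l` given the future at
time `0`. -/
def posterior (l : ℕ) (i : CausalState μ) : (ℤ → A) → ℝ :=
  μ[(stateEvent μ l i.1).indicator (fun _ => (1 : ℝ)) | MeasurableSpace.comap future inferInstance]

theorem measurable_posterior (l : ℕ) (i : CausalState μ) : Measurable (posterior l i) :=
  (stronglyMeasurable_condExp.mono comap_future_le).measurable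

theorem posterior_nonneg (l : ℕ) (i : CausalState μ) : ∀ᵐ x ∂μ, 0 ≤ posterior l i x :=
  condExp_nonneg (ae_of_all _ fun x => Set.indicator_nonneg (fun _ _ => zero_le_one) x)

theorem setIntegral_posterior (l : ℕ) (i : CausalState μ) {B : Set (ℕ → A)}
    (hB : MeasurableSet B) :
    ∫ x in future ⁻¹' B, posterior l i x ∂μ = μ.real (stateEvent μ l i.1 ∩ future ⁻¹' B) := by
  rw [posterior, setIntegral_condExp comap_future_le
    (integrable_indicator_one (measurableSet_stateEvent l i)) ⟨B, hB, rfl⟩,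
    setIntegral_indicator (measurableSet_stateEvent l i)]
  simp [Set.inter_comm]

theorem posterior_add_le_one (l : ℕ) {i j : CausalState μ} (hij : i ≠ j) :
    ∀ᵐ x ∂μ, posterior l i x + posterior l j x ≤ 1 := by
  have hi := integrable_indicator_one (μ := μ) (measurableSet_stateEvent l i)
  have hj := integrable_indicator_one (μ := μ) (measurableSet_stateEvent l j)
  have h1 := condExp_mono (m := MeasurableSpace.comap (future (A := A)) inferInstance) (hi.add hj)
    (integrable_const (1 : ℝ)) (ae_of_all μ fun x => by
      have hd : x ∈ stateEvent μ l i.1 → x ∉ stateEvent μ l j.1 := fun h =>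
        Set.disjoint_left.1 (pairwise_disjoint_stateEvent (μ := μ) l hij) h
      by_cases hx : x ∈ stateEvent μ l i.1
      · simp [hx, hd hx]
      · by_cases hx' : x ∈ stateEvent μ l j.1 <;> simp [hx, hx'])
  rw [condExp_const comap_future_le] at h1
  filter_upwards [h1, condExp_add hi hj _] with x hx1 hx2
  rw [hx2] at hx1
  exact hx1

theorem posterior_le_one (l : ℕ) (i : CausalState μ) : ∀ᵐ x ∂μ, posterior l i x ≤ 1 := by
  have hi := integrable_indicator_one (μ := μ) (measurableSet_stateEvent l i)
  have h1 := condExp_mono (m := MeasurableSpace.comap (future (A := A)) inferInstance) hi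
    (integrable_const (1 : ℝ)) (ae_of_all μ fun x =>
      Set.indicator_le_self' (fun _ _ => zero_le_one) x)
  rwa [condExp_const comap_future_le] at h1

theorem condExp_state_inter_cyl (i : CausalState μ) (w : List A) :
    μ[(stateEvent μ 0 i.1 ∩ future ⁻¹' cyl w).indicator (fun _ => (1 : ℝ)) |
      MeasurableSpace.comap future inferInstance]
      =ᵐ[μ] (future ⁻¹' cyl w).indicator (posterior 0 i) := by
  rw [Set.inter_comm, ← Set.indicator_indicator]
  exact condExp_indicator (integrable_indicator_one (measurableSet_stateEvent 0 i))
    ⟨_, measurableSet_cyl w, rfl⟩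

/-- A state that emits `w` with probability zero is excluded by the futures that begin with `w`. -/
theorem posterior_eq_zero_of_cyl {i : CausalState μ} {w : List A}
    (h : stateLaw μ i (cyl w) = 0) :
    ∀ᵐ x ∂μ, future x ∈ cyl w → posterior 0 i x = 0 := by
  have h0 : (stateEvent μ 0 i.1 ∩ future ⁻¹' cyl w).indicator (fun _ => (1 : ℝ)) =ᵐ[μ] 0 := by
    refine indicator_meas_zero ?_
    rw [measure_state_future i (measurableSet_cyl w), h, mul_zero]
  have h1 := condExp_congr_ae (m := MeasurableSpace.comap (future (A := A)) inferInstance) h0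
  rw [condExp_zero] at h1
  filter_upwards [h1, condExp_state_inter_cyl i w] with x hx1 hx2 hx
  rw [hx2] at hx1
  simpa [Set.indicator_of_mem (show x ∈ future ⁻¹' cyl w from hx)] using hx1

/-- On the cylinder of `w`, the event `S_0 = i` is contained in `S_{|w|} = k`. -/
theorem Leads.posterior_le (hμ : IsStationary μ) {i k : CausalState μ} {w : List A}
    (h : Leads i w k) :
    ∀ᵐ x ∂μ, future x ∈ cyl w → posterior 0 i x ≤ posterior w.length k x := by
  have hm := (measurableSet_stateEvent 0 i).inter (measurable_future (measurableSet_cyl w))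
  have h1 := condExp_mono (m := MeasurableSpace.comap (future (A := A)) inferInstance)
    (integrable_indicator_one (μ := μ) hm)
    (integrable_indicator_one (measurableSet_stateEvent w.length k)) (by
      filter_upwards [h.ae_mem hμ] with x hx
      by_cases hx' : x ∈ stateEvent μ 0 i.1 ∩ future ⁻¹' cyl w
      · simp [hx', hx hx'.1 hx'.2]
      · rw [Set.indicator_of_notMem hx']
        exact Set.indicator_nonneg (fun _ _ => zero_le_one) x)
  filter_upwards [h1, condExp_state_inter_cyl i w] with x hx1 hx2 hx
  rw [hx2, Set.indicator_of_mem (show x ∈ future ⁻¹' cyl w from hx)] at hx1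
  exact hx1

theorem integral_state_inter (i : CausalState μ) (w : List A) {B : Set (ℕ → A)}
    (hB : MeasurableSet B) :
    ∫ x in future ⁻¹' B, (stateEvent μ 0 i.1 ∩ future ⁻¹' cyl w).indicator (fun _ => (1 : ℝ)) x ∂μ
      = stateProb μ i * (stateLaw μ i).real (B ∩ cyl w) := by
  have hm := (measurableSet_stateEvent 0 i).inter (measurable_future (measurableSet_cyl w))
  rw [setIntegral_indicator hm]
  have hset : future ⁻¹' B ∩ (stateEvent μ 0 i.1 ∩ future ⁻¹' cyl w)
      = stateEvent μ 0 i.1 ∩ future ⁻¹' (B ∩ cyl w) := by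
    ext x
    simp only [Set.mem_inter_iff, Set.mem_preimage]
    tauto
  rw [hset, setIntegral_const, measureReal_def,
    measure_state_future i (hB.inter (measurableSet_cyl w))]
  simp [stateProb, measureReal_def]

/-- After a word that synchronizes two states, their posterior probabilities are in a fixed
proportion: the rest of the future does not distinguish them. -/
theorem posterior_proportional {i j k : CausalState μ} {w : List A} (hi : Leads i w k)
    (hj : Leads j w k) :
    ∀ᵐ x ∂μ, future x ∈ cyl w →
      stateProb μ j * (stateLaw μ j).real (cyl w) * posterior 0 i x
        = stateProb μ i * (stateLaw μ i).real (cyl w) * posterior 0 j x := by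
  set m := MeasurableSpace.comap (future (A := A)) inferInstance with hmdef
  set α := stateProb μ i * (stateLaw μ i).real (cyl w)
  set β := stateProb μ j * (stateLaw μ j).real (cyl w)
  set f := (stateEvent μ 0 i.1 ∩ future ⁻¹' cyl w).indicator (fun _ => (1 : ℝ))
  set g := (stateEvent μ 0 j.1 ∩ future ⁻¹' cyl w).indicator (fun _ => (1 : ℝ))
  have hf : Integrable f μ := integrable_indicator_one
    ((measurableSet_stateEvent 0 i).inter (measurable_future (measurableSet_cyl w)))
  have hg : Integrable g μ := integrable_indicator_one
    ((measurableSet_stateEvent 0 j).inter (measurable_future (measurableSet_cyl w)))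
  have hreal : ∀ {i' : CausalState μ}, Leads i' w k → ∀ {B}, MeasurableSet B →
      (stateLaw μ i').real (B ∩ cyl w)
        = (stateLaw μ i').real (cyl w) * (stateLaw μ k).real (prepend w ⁻¹' B) := by
    intro i' h' B hB
    simp only [measureReal_def]
    rw [h'.apply_inter hB, ENNReal.toReal_mul]
  -- `β P(i | fut) - α P(j | fut)` has integral zero over every event `B` in the future, since `w`
  -- splits off a factor that depends on `k` and `B` only
  have h0 : (fun _ => (0 : ℝ)) =ᵐ[μ] μ[β • f - α • g | m] := by
    refine ae_eq_condExp_of_forall_setIntegral_eq comap_future_le ((hf.smul β).sub (hg.smul α))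
      (fun s _ _ => integrableOn_zero) ?_ aestronglyMeasurable_const
    rintro s ⟨B, hB, rfl⟩ -
    have hs : ∀ h : (ℤ → A) → ℝ, Integrable h μ → IntegrableOn h (future ⁻¹' B) μ :=
      fun h hh => hh.integrableOn
    rw [integral_sub' (hs _ (hf.smul β)) (hs _ (hg.smul α))]
    simp only [Pi.smul_apply]
    rw [integral_smul, integral_smul,
      integral_state_inter i w hB, integral_state_inter j w hB, hreal hi hB, hreal hj hB]
    simp only [integral_zero, smul_eq_mul, α, β]
    ring
  filter_upwards [h0, condExp_sub (hf.smul β) (hg.smul α) m, condExp_smul β f m,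
    condExp_smul α g m, condExp_state_inter_cyl i w, condExp_state_inter_cyl j w]
    with x h0 h1 h2 h3 h4 h5 hx
  rw [h1, Pi.sub_apply, h2, h3, Pi.smul_apply, Pi.smul_apply, h4, h5,
    Set.indicator_of_mem (show x ∈ future ⁻¹' cyl w from hx),
    Set.indicator_of_mem (show x ∈ future ⁻¹' cyl w from hx)] at h0
  simpa [smul_eq_mul, sub_eq_zero] using h0.symm

theorem measurable_sqrt_posterior (i j : CausalState μ) :
    Measurable fun x => Real.sqrt (posterior 0 i x * posterior 0 j x) :=
  ((measurable_posterior 0 i).mul (measurable_posterior 0 j)).sqrt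

theorem integrable_posterior_mul (i j : CausalState μ) :
    Integrable (fun x => posterior 0 i x * posterior 0 j x) μ := by
  refine Integrable.of_bound
    ((measurable_posterior 0 i).mul (measurable_posterior 0 j)).aestronglyMeasurable 1 ?_
  filter_upwards [posterior_nonneg 0 i, posterior_nonneg 0 j, posterior_le_one 0 i,
    posterior_le_one 0 j] with x h1 h2 h3 h4
  rw [Real.norm_eq_abs, abs_of_nonneg (mul_nonneg h1 h2)]
  exact mul_le_one₀ h3 h2 h4

theorem integrable_sqrt_posterior (i j : CausalState μ) :
    Integrable (fun x => Real.sqrt (posterior 0 i x * posterior 0 j x)) μ := by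
  refine Integrable.of_bound (measurable_sqrt_posterior i j).aestronglyMeasurable 1 ?_
  filter_upwards [posterior_nonneg 0 i, posterior_nonneg 0 j, posterior_le_one 0 i,
    posterior_le_one 0 j] with x h1 h2 h3 h4
  rw [Real.norm_eq_abs, abs_of_nonneg (Real.sqrt_nonneg _), Real.sqrt_le_iff]
  exact ⟨zero_le_one, by rw [one_pow]; exact mul_le_one₀ h3 h2 h4⟩

theorem setIntegral_cyl_sqrt_posterior {i j k : CausalState μ} {w : List A} (hi : Leads i w k)
    (hj : Leads j w k) :
    ∫ x in future ⁻¹' cyl w, Real.sqrt (posterior 0 i x * posterior 0 j x) ∂μ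
      = Real.sqrt (stateProb μ i) * Real.sqrt (stateProb μ j) *
        (Real.sqrt ((stateLaw μ i).real (cyl w)) * Real.sqrt ((stateLaw μ j).real (cyl w))) := by
  have hpos : ∀ {i'}, Leads i' w k → 0 < stateProb μ i' * (stateLaw μ i').real (cyl w) :=
    fun h => mul_pos (stateProb_pos _) (ENNReal.toReal_pos h.1 (measure_ne_top _ _))
  have hα := hpos hi
  have hβ := hpos hj
  have hint := setIntegral_posterior 0 i (μ := μ) (measurableSet_cyl w)
  rw [measureReal_def, Nat.cast_zero, measure_state_future i (measurableSet_cyl w),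
    ENNReal.toReal_mul] at hint
  change _ = stateProb μ i * (stateLaw μ i).real (cyl w) at hint
  have hr : Real.sqrt (stateProb μ i) * Real.sqrt (stateProb μ j) *
      (Real.sqrt ((stateLaw μ i).real (cyl w)) * Real.sqrt ((stateLaw μ j).real (cyl w)))
      = Real.sqrt (stateProb μ i * (stateLaw μ i).real (cyl w)) *
        Real.sqrt (stateProb μ j * (stateLaw μ j).real (cyl w)) := by
    rw [Real.sqrt_mul (stateProb_pos i).le, Real.sqrt_mul (stateProb_pos j).le]
    ring
  rw [hr]
  set α := stateProb μ i * (stateLaw μ i).real (cyl w) with hαdef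
  set β := stateProb μ j * (stateLaw μ j).real (cyl w) with hβdef
  have hae : ∀ᵐ x ∂μ, x ∈ future ⁻¹' cyl w →
      Real.sqrt (posterior 0 i x * posterior 0 j x)
        = Real.sqrt β / Real.sqrt α * posterior 0 i x := by
    filter_upwards [posterior_proportional hi hj, posterior_nonneg 0 i] with x hx hx0 hxw
    have h1 : posterior 0 j x = β / α * posterior 0 i x := by
      field_simp
      rw [mul_comm (posterior 0 j x), ← hx hxw]
    rw [h1, show posterior 0 i x * (β / α * posterior 0 i x) = β / α * posterior 0 i x ^ 2 by ring,
      Real.sqrt_mul (by positivity), Real.sqrt_sq hx0, Real.sqrt_div hβ.le]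
  rw [setIntegral_congr_ae (measurable_future (measurableSet_cyl w)) hae, integral_const_mul, hint]
  have hsα : 0 < Real.sqrt α := Real.sqrt_pos.2 hα
  rw [div_mul_eq_mul_div, div_eq_iff hsα.ne']
  nth_rewrite 1 [← Real.mul_self_sqrt hα.le]
  ring

/-- The overlap of `|S_i(l)⟩` and `|S_j(l)⟩` is the Hellinger affinity of the laws of the future
in the states `i` and `j`, restricted to the futures that synchronize the two states within `l`
steps. -/
theorem inner_qState (hμ : IsStationary μ) (l : ℕ) (i j : CausalState μ) :
    ((Real.sqrt (stateProb μ i) * Real.sqrt (stateProb μ j) : ℝ) : ℂ) *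
        inner ℂ (qState μ l i) (qState μ l j)
      = ((∫ x in future ⁻¹' mergeSet l i j,
          Real.sqrt (posterior 0 i x * posterior 0 j x) ∂μ : ℝ) : ℂ) := by
  have h1 := hasSum_integral_iUnion (μ := μ)
    (f := fun x => Real.sqrt (posterior 0 i x * posterior 0 j x))
    (s := fun c => future ⁻¹' mergeCyl l i j c)
    (fun c => measurable_future (measurableSet_mergeCyl l i j c))
    (fun c c' h => (pairwise_disjoint_mergeCyl l i j h).preimage _)
    (integrable_sqrt_posterior i j).integrableOn
  rw [← Set.preimage_iUnion] at h1
  have h2 := (lp.hasSum_inner (qState μ l i) (qState μ l j)).mul_left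
    ((Real.sqrt (stateProb μ i) * Real.sqrt (stateProb μ j) : ℝ) : ℂ)
  refine h2.unique ((Complex.hasSum_ofReal.2 h1).congr_fun ?_)
  rintro ⟨w, k⟩
  rw [qState_hasAmplitudes hμ l i w k, qState_hasAmplitudes hμ l j w k]
  by_cases hw : w.length = l ∧ Leads i w k ∧ Leads j w k
  · rw [if_pos ⟨hw.1, hw.2.1⟩, if_pos ⟨hw.1, hw.2.2⟩]
    simp only [mergeCyl, if_pos hw]
    rw [setIntegral_cyl_sqrt_posterior hw.2.1 hw.2.2]
    simp [mul_comm]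
  · simp only [mergeCyl, if_neg hw]
    by_cases hi : w.length = l ∧ Leads i w k
    · have hj : ¬ (w.length = l ∧ Leads j w k) := fun hj => hw ⟨hi.1, hi.2, hj.2⟩
      simp [hj]
    · simp [hi]

end Posterior

/-! ### Synchronization -/

/-- A conditional distribution depends only on the joint law. -/
theorem condDistrib_eq_of_map_eq {Ω Ω' E F : Type*} [MeasurableSpace Ω] [MeasurableSpace Ω']
    [MeasurableSpace E] [MeasurableSpace F] [StandardBorelSpace F] [Nonempty F] {m : Measure Ω}
    {m' : Measure Ω'} [IsFiniteMeasure m] [IsFiniteMeasure m'] {X : Ω → E} {Y : Ω → F} {X' : Ω' → E}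
    {Y' : Ω' → F} (h : m.map (fun a => (X a, Y a)) = m'.map fun a => (X' a, Y' a)) :
    condDistrib Y X m = condDistrib Y' X' m' := by
  have aux : ∀ (ρ ρ' : Measure (E × F)) [IsFiniteMeasure ρ] [IsFiniteMeasure ρ'], ρ = ρ' →
      ρ.condKernel = ρ'.condKernel := by
    rintro ρ ρ' _ _ rfl
    rfl
  rw [condDistrib, condDistrib]
  exact aux _ _ h

section Filtration

variable (A : Type*) [MeasurableSpace A]

/-- The information in the observations from time `-l` on. -/
def futureFiltration : Filtration ℕ (MeasurableSpace.pi : MeasurableSpace (ℤ → A)) where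
  seq l := MeasurableSpace.comap (futureFrom (-l)) inferInstance
  mono' := by
    intro l m hlm
    have h : futureFrom (A := A) (-l) = dropSeq (m - l) ∘ futureFrom (-m) := by
      ext x n
      simp only [futureFrom, dropSeq, Function.comp_apply]
      congr 1
      omega
    change MeasurableSpace.comap (futureFrom (-(l : ℤ))) inferInstance ≤
      MeasurableSpace.comap (futureFrom (-(m : ℤ))) inferInstance
    rw [h, ← MeasurableSpace.comap_comp]
    exact MeasurableSpace.comap_mono (measurable_dropSeq _).comap_le
  le' l := (measurable_futureFrom _).comap_le

theorem iSup_futureFiltration :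
    ⨆ l, futureFiltration A l = (MeasurableSpace.pi : MeasurableSpace (ℤ → A)) := by
  refine le_antisymm (iSup_le fun l => (futureFiltration A).le l) (iSup_le fun t => ?_)
  refine le_trans ?_ (le_iSup (fun l => futureFiltration A l) t.natAbs)
  have h : (fun x : ℤ → A => x t)
      = (fun f : ℕ → A => f (t + t.natAbs).toNat) ∘ futureFrom (-(t.natAbs : ℤ)) := by
    ext x
    simp only [futureFrom, Function.comp_apply]
    congr 1
    omega
  rw [h, ← MeasurableSpace.comap_comp]
  exact MeasurableSpace.comap_mono (measurable_pi_apply _).comap_le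

end Filtration

section Synchronization

variable {A : Type*} [Countable A] [Nonempty A] [MeasurableSpace A] [DiscreteMeasurableSpace A]

/-- The mean residual uncertainty `∑_k E[Q_k (1 - Q_k)]` about the state at time `l`, where
`Q_k = P(S_l = k | X_{0:∞})`. -/
def uncertainty (μ : Measure (ℤ → A)) [IsProbabilityMeasure μ] (l : ℕ) : ℝ≥0∞ :=
  ∑' k : CausalState μ, ∫⁻ x, ENNReal.ofReal (posterior l k x * (1 - posterior l k x)) ∂μ

variable {μ : Measure (ℤ → A)} [IsProbabilityMeasure μ]

theorem measurable_posterior_variance (l : ℕ) (k : CausalState μ) :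
    Measurable fun x => ENNReal.ofReal (posterior l k x * (1 - posterior l k x)) :=
  ((measurable_posterior l k).mul (measurable_const.sub (measurable_posterior l k))).ennreal_ofReal

/-- If the first `l` symbols lead from `i` and `j` to distinct states `k` and `k'`, then the
posterior probabilities of `i` and `j` are at most `Q_k` and `Q_{k'} ≤ 1 - Q_k`, where
`Q_k = P(S_l = k | X_{0:∞})`. -/
theorem posterior_mul_le_of_notMem_mergeSet (hμ : IsStationary μ) (l : ℕ) (i j : CausalState μ) :
    ∀ᵐ x ∂μ, future x ∉ mergeSet l i j →
      ENNReal.ofReal (posterior 0 i x * posterior 0 j x) ≤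
        ∑' k : CausalState μ, ENNReal.ofReal (posterior l k x * (1 - posterior l k x)) := by
  have key : ∀ w : List A, w.length = l → ∀ᵐ x ∂μ, future x ∈ cyl w → future x ∉ mergeSet l i j →
      ENNReal.ofReal (posterior 0 i x * posterior 0 j x) ≤
        ∑' k : CausalState μ, ENNReal.ofReal (posterior l k x * (1 - posterior l k x)) := by
    intro w hw
    by_cases hi : stateLaw μ i (cyl w) = 0
    · filter_upwards [posterior_eq_zero_of_cyl hi] with x hx hxw _
      simp [hx hxw]
    by_cases hj : stateLaw μ j (cyl w) = 0
    · filter_upwards [posterior_eq_zero_of_cyl hj] with x hx hxw _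
      simp [hx hxw]
    obtain ⟨k, hk, -⟩ := exists_leads hμ hi
    obtain ⟨k', hk', -⟩ := exists_leads hμ hj
    by_cases hkk : k = k'
    · subst hkk
      refine ae_of_all _ fun x hxw hxm => absurd (Set.mem_iUnion.2 ⟨(w, k), ?_⟩) hxm
      simp only [mergeCyl,
        if_pos (show w.length = l ∧ Leads i w k ∧ Leads j w k from ⟨hw, hk, hk'⟩)]
      exact hxw
    · filter_upwards [hk.posterior_le hμ, hk'.posterior_le hμ, posterior_add_le_one w.length hkk,
        posterior_nonneg 0 i, posterior_nonneg 0 j, posterior_nonneg w.length k]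
        with x h1 h2 h3 h4 h5 h6 hxw _
      rw [hw] at *
      refine le_trans (ENNReal.ofReal_le_ofReal ?_) (ENNReal.le_tsum k)
      exact mul_le_mul (h1 hxw) (by linarith [h2 hxw]) h5 h6
  have h2 : ∀ᵐ x ∂μ, ∀ w : List A, w.length = l → future x ∈ cyl w → future x ∉ mergeSet l i j →
      ENNReal.ofReal (posterior 0 i x * posterior 0 j x) ≤
        ∑' k : CausalState μ, ENNReal.ofReal (posterior l k x * (1 - posterior l k x)) := by
    refine ae_all_iff.2 fun w => ?_
    by_cases hw : w.length = l
    · filter_upwards [key w hw] with x hx _ using hx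
    · exact ae_of_all _ fun x h => absurd h hw
  filter_upwards [h2] with x hx
  obtain ⟨w, hw, hxw⟩ := exists_mem_cyl l (future x)
  exact hx w hw hxw

theorem setLIntegral_compl_mergeSet_le (hμ : IsStationary μ) (l : ℕ) (i j : CausalState μ) :
    ∫⁻ x in (future ⁻¹' mergeSet l i j)ᶜ,
      ENNReal.ofReal (posterior 0 i x * posterior 0 j x) ∂μ ≤ uncertainty μ l := by
  have hM : MeasurableSet (future ⁻¹' mergeSet l i j) :=
    measurable_future (measurableSet_mergeSet l i j)
  refine (setLIntegral_mono_ae' hM.compl (posterior_mul_le_of_notMem_mergeSet hμ l i j)).trans ?_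
  refine (setLIntegral_le_lintegral _ _).trans ?_
  rw [lintegral_tsum fun k => (measurable_posterior_variance l k).aemeasurable]
  rfl

/-- The affinity missed by the futures that do not synchronize `i` and `j` within `l` steps is
controlled by the uncertainty about the state at time `l`. -/
theorem sq_integral_sub_le_uncertainty (hμ : IsStationary μ) (l : ℕ) (i j : CausalState μ) :
    ENNReal.ofReal ((∫ x, Real.sqrt (posterior 0 i x * posterior 0 j x) ∂μ -
      ∫ x in future ⁻¹' mergeSet l i j, Real.sqrt (posterior 0 i x * posterior 0 j x) ∂μ) ^ 2)
      ≤ uncertainty μ l := by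
  have hM : MeasurableSet (future ⁻¹' mergeSet l i j) :=
    measurable_future (measurableSet_mergeSet l i j)
  have hg := integrable_posterior_mul i j
  have hs := integrable_sqrt_posterior i j
  have hnn : ∀ᵐ x ∂μ, 0 ≤ posterior 0 i x * posterior 0 j x := by
    filter_upwards [posterior_nonneg 0 i, posterior_nonneg 0 j] with x h1 h2 using mul_nonneg h1 h2
  rw [← setIntegral_compl hM hs]
  set N := (future ⁻¹' mergeSet l i j)ᶜ
  set h : (ℤ → A) → ℝ := N.indicator fun x => Real.sqrt (posterior 0 i x * posterior 0 j x) with hh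
  have hN : MeasurableSet N := hM.compl
  have hhint : Integrable h μ := hs.indicator hN
  have hsq : (fun x => h x ^ 2) =ᵐ[μ] N.indicator fun x => posterior 0 i x * posterior 0 j x := by
    filter_upwards [hnn] with x hx
    by_cases hxN : x ∈ N
    · simp [hh, hxN, Real.sq_sqrt hx]
    · simp [hh, hxN]
  have hsqint : Integrable (fun x => h x ^ 2) μ := (hg.indicator hN).congr hsq.symm
  set J := ∫ x in N, Real.sqrt (posterior 0 i x * posterior 0 j x) ∂μ with hJ
  have hJh : ∫ x, h x ∂μ = J := integral_indicator hN
  -- Jensen's inequality `(E h)² ≤ E h²`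
  have hvar : J ^ 2 ≤ ∫ x in N, posterior 0 i x * posterior 0 j x ∂μ := by
    have h0 : 0 ≤ ∫ x, (h x ^ 2 - (2 * J) * h x + J ^ 2) ∂μ :=
      integral_nonneg fun x => by
        have := sq_nonneg (h x - J)
        simp only [Pi.zero_apply]
        linarith [this]
    have hlin : Integrable (fun x => h x ^ 2 - (2 * J) * h x) μ :=
      hsqint.sub (hhint.const_mul _)
    rw [integral_add hlin (integrable_const _), integral_sub hsqint (hhint.const_mul _),
      integral_const_mul, hJh, integral_congr_ae hsq,
      integral_indicator hN] at h0
    simp only [integral_const, probReal_univ, smul_eq_mul, one_mul] at h0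
    linarith
  refine (ENNReal.ofReal_le_ofReal hvar).trans ?_
  rw [ofReal_integral_eq_lintegral_ofReal hg.integrableOn (ae_restrict_of_ae hnn)]
  exact setLIntegral_compl_mergeSet_le hμ l i j

/-- If the posterior entropy vanishes, all posterior probabilities are `0` or `1`. -/
theorem uncertainty_eq_zero {l : ℕ} (h : condStateEntropy μ l = 0) : uncertainty μ l = 0 := by
  have hmeas : Measurable fun x => ∑' k : CausalState μ,
      ENNReal.ofReal (Real.negMulLog (posterior l k x)) := Measurable.tsum fun k =>
    (Real.continuous_negMulLog.measurable.comp (measurable_posterior l k)).ennreal_ofReal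
  have h1 : ∀ᵐ x ∂μ, ∑' k : CausalState μ, ENNReal.ofReal (Real.negMulLog (posterior l k x)) = 0 :=
    (lintegral_eq_zero_iff hmeas).1 h
  refine ENNReal.tsum_eq_zero.2 fun k => ?_
  rw [lintegral_eq_zero_iff (measurable_posterior_variance l k)]
  filter_upwards [h1, posterior_nonneg l k, posterior_le_one l k] with x hx h0 h1
  have hk : Real.negMulLog (posterior l k x) ≤ 0 :=
    ENNReal.ofReal_eq_zero.1 (ENNReal.tsum_eq_zero.1 hx k)
  have h3 : posterior l k x = 0 ∨ posterior l k x = 1 := by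
    by_contra! hne
    have hpos : 0 < posterior l k x := lt_of_le_of_ne h0 hne.1.symm
    have hlog := Real.log_neg hpos (lt_of_le_of_ne h1 hne.2)
    rw [Real.negMulLog] at hk
    nlinarith [mul_pos hpos (neg_pos.2 hlog)]
  rcases h3 with h3 | h3 <;> simp [h3]

/-- By stationarity, the uncertainty about the state at time `l` given the future at time `0` is
that about the state at time `0` given the observations from time `-l` on. -/
theorem lintegral_posterior_eq (hμ : IsStationary μ) (l : ℕ) (k : CausalState μ) :
    ∫⁻ x, ENNReal.ofReal (posterior l k x * (1 - posterior l k x)) ∂μ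
      = ∫⁻ x, ENNReal.ofReal
          ((μ[(stateEvent μ 0 k.1).indicator (fun _ => (1 : ℝ)) | futureFiltration A l]) x *
          (1 - (μ[(stateEvent μ 0 k.1).indicator (fun _ => (1 : ℝ)) | futureFiltration A l]) x))
          ∂μ := by
  have hS := measurableSet_statePasts k
  have hlaw : μ.map (fun x => (future x, pastAt l x))
      = μ.map (fun x => (futureFrom (-l) x, pastAt 0 x)) := by
    have h := congrArg (Measure.map Prod.swap) (hμ.map_past_future l (-l))
    rw [Measure.map_map measurable_swap (by fun_prop),
      Measure.map_map measurable_swap (by fun_prop),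
      neg_add_cancel, futureFrom_zero] at h
    exact h
  have hcd : condDistrib (pastAt (l : ℤ)) future μ = condDistrib (pastAt 0) (futureFrom (-l)) μ :=
    condDistrib_eq_of_map_eq hlaw
  have hfst : μ.map future = μ.map (futureFrom (A := A) (-l)) := by
    have h := congrArg (Measure.map Prod.fst) hlaw
    rw [Measure.map_map measurable_fst (by fun_prop), Measure.map_map measurable_fst (by fun_prop)]
      at h
    exact h
  have h1 := condDistrib_ae_eq_condExp (μ := μ) (measurable_future (A := A))
    (measurable_pastAt (l : ℤ)) hS
  have h2 := condDistrib_ae_eq_condExp (μ := μ) (measurable_futureFrom (A := A) (-l))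
    (measurable_pastAt 0) hS
  rw [← stateEvent_eq] at h1 h2
  rw [hcd] at h1
  set κ := condDistrib (pastAt 0) (futureFrom (-l)) μ
  have hκ : Measurable fun y => (κ y).real (statePasts μ k) :=
    (κ.measurable_coe hS).ennreal_toReal
  have hF : Measurable fun y =>
      ENNReal.ofReal ((κ y).real (statePasts μ k) * (1 - (κ y).real (statePasts μ k))) :=
    (hκ.mul (measurable_const.sub hκ)).ennreal_ofReal
  trans ∫⁻ y, ENNReal.ofReal ((κ y).real (statePasts μ k) * (1 - (κ y).real (statePasts μ k)))
    ∂(μ.map future)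
  · rw [lintegral_map hF measurable_future]
    refine lintegral_congr_ae ?_
    filter_upwards [h1] with x hx
    rw [hx]
    rfl
  · rw [hfst, lintegral_map hF (measurable_futureFrom _)]
    refine lintegral_congr_ae ?_
    filter_upwards [h2] with x hx
    rw [hx]
    rfl

/-- Each state is determined by the two-sided sequence of observations, so by Lévy's upward theorem
it becomes certain as more and more observations are taken into account. -/
theorem tendsto_lintegral_posterior (hμ : IsStationary μ) (k : CausalState μ) :
    Tendsto (fun l : ℕ => ∫⁻ x, ENNReal.ofReal (posterior l k x * (1 - posterior l k x)) ∂μ) atTop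
      (𝓝 0) := by
  simp only [lintegral_posterior_eq hμ]
  set g := (stateEvent μ 0 k.1).indicator (fun _ => (1 : ℝ)) with hg
  have hgm : Measurable g := measurable_const.indicator (measurableSet_stateEvent 0 k)
  have hlim : ∀ᵐ x ∂μ, Tendsto (fun l => (μ[g | futureFiltration A l]) x) atTop (𝓝 (g x)) := by
    have h := tendsto_ae_condExp (μ := μ) (ℱ := futureFiltration A) g
    rwa [iSup_futureFiltration, condExp_of_stronglyMeasurable le_rfl hgm.stronglyMeasurable
      (integrable_indicator_one (measurableSet_stateEvent 0 k))] at h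
  have hmeas : ∀ l, Measurable (μ[g | futureFiltration A l]) := fun l =>
    (stronglyMeasurable_condExp.mono ((futureFiltration A).le l)).measurable
  have h0 : (0 : ℝ≥0∞) = ∫⁻ _, 0 ∂μ := by simp
  rw [h0]
  refine tendsto_lintegral_of_dominated_convergence (fun _ => 1)
    (fun l => ((hmeas l).mul (measurable_const.sub (hmeas l))).ennreal_ofReal) (fun l => ?_)
    (by simp) ?_
  · refine ae_of_all _ fun x => ?_
    rw [← ENNReal.ofReal_one]
    refine ENNReal.ofReal_le_ofReal ?_
    nlinarith [sq_nonneg ((μ[g | futureFiltration A l]) x - 1 / 2)]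
  · filter_upwards [hlim] with x hx
    have h1 := (ENNReal.continuous_ofReal.tendsto _).comp (hx.mul (hx.const_sub 1))
    have h2 : g x * (1 - g x) = 0 := by
      by_cases hxs : x ∈ stateEvent μ 0 k.1 <;> simp [hg, hxs]
    rw [h2, ENNReal.ofReal_zero] at h1
    exact h1

theorem lintegral_posterior_le (hμ : IsStationary μ) (l : ℕ) (k : CausalState μ) :
    ∫⁻ x, ENNReal.ofReal (posterior l k x * (1 - posterior l k x)) ∂μ
      ≤ μ (stateEvent μ 0 k.1) := by
  have hint : Integrable (posterior l k) μ := integrable_condExp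
  have h1 : ∫⁻ x, ENNReal.ofReal (posterior l k x) ∂μ = μ (stateEvent μ 0 k.1) := by
    rw [← ofReal_integral_eq_lintegral_ofReal hint (posterior_nonneg l k)]
    have h2 := setIntegral_posterior (μ := μ) l k MeasurableSet.univ
    simp only [Set.preimage_univ, setIntegral_univ, Set.inter_univ] at h2
    rw [h2, ofReal_measureReal, stateEvent_eq, stateEvent_eq, hμ.measure_past _
      (measurableSet_statePasts k)]
  rw [← h1]
  refine lintegral_mono_ae ?_
  filter_upwards [posterior_nonneg l k] with x hx
  refine ENNReal.ofReal_le_ofReal ?_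
  nlinarith [sq_nonneg (posterior l k x)]

theorem tendsto_uncertainty (hμ : IsStationary μ) : Tendsto (uncertainty μ) atTop (𝓝 0) := by
  let _ : MeasurableSpace (CausalState μ) := ⊤
  have h0 : (0 : ℝ≥0∞) = ∫⁻ _ : CausalState μ, 0 ∂Measure.count := by simp
  have h1 : uncertainty μ = fun l => ∫⁻ k : CausalState μ,
      ∫⁻ x, ENNReal.ofReal (posterior l k x * (1 - posterior l k x)) ∂μ ∂Measure.count := by
    ext l
    rw [lintegral_count]
    rfl
  rw [h0, h1]
  refine tendsto_lintegral_of_dominated_convergence (fun k => μ (stateEvent μ 0 k.1))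
    (fun l => measurable_from_top) (fun l => ae_of_all _ fun k => lintegral_posterior_le hμ l k) ?_
    (ae_of_all _ fun k => tendsto_lintegral_posterior hμ k)
  rw [lintegral_count]
  refine ne_top_of_le_ne_top (measure_ne_top μ Set.univ) ?_
  exact tsum_measure_le_measure_univ (fun k => (measurableSet_stateEvent 0 k).nullMeasurableSet)
    fun i j hij => (pairwise_disjoint_stateEvent (μ := μ) 0 hij).aedisjoint

end Synchronization

/-! ### Time reversal -/

theorem pastAt_reverse {A : Type*} (x : ℤ → A) : pastAt 0 (fun t => x (-(t + 1))) = future x := by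
  ext n
  simp only [pastAt, future]
  congr 1
  ring

theorem future_reverse {A : Type*} (x : ℤ → A) : future (fun t => x (-(t + 1))) = pastAt 0 x := by
  ext n
  simp only [pastAt, future]
  congr 1
  ring

section Reversal

variable {A : Type*} [MeasurableSpace A]

theorem measurable_reverse : Measurable fun (x : ℤ → A) t => x (-(t + 1)) :=
  measurable_pi_lambda _ fun _ => measurable_pi_apply _

instance (μ : Measure (ℤ → A)) [IsProbabilityMeasure μ] : IsProbabilityMeasure (timeReversal μ) :=
  Measure.isProbabilityMeasure_map measurable_reverse.aemeasurable

theorem IsStationary.timeReversal {μ : Measure (ℤ → A)} (hμ : IsStationary μ) :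
    IsStationary (timeReversal μ) := by
  intro t
  have hθ : ∀ t : ℤ, Measurable fun (x : ℤ → A) s => x (s + t) := fun t =>
    measurable_pi_lambda _ fun _ => measurable_pi_apply _
  unfold QMachine.timeReversal
  conv_rhs => rw [← hμ (-t)]
  rw [Measure.map_map (hθ t) measurable_reverse, Measure.map_map measurable_reverse (hθ (-t))]
  congr 1
  ext x s
  simp only [Function.comp_apply]
  congr 1
  ring

theorem timeReversal_map_past_future (μ : Measure (ℤ → A)) :
    (timeReversal μ).map (fun x => (pastAt 0 x, future x))
      = μ.map fun x => (future x, pastAt 0 x) := by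
  unfold timeReversal
  have h : Measurable fun x : ℤ → A => (pastAt 0 x, future x) := by fun_prop
  rw [Measure.map_map h measurable_reverse]
  congr 1
  ext x : 1
  simp only [Function.comp_apply, pastAt_reverse, future_reverse]

theorem timeReversal_map_future_past (μ : Measure (ℤ → A)) :
    (timeReversal μ).map (fun x => (future x, pastAt 0 x))
      = μ.map fun x => (pastAt 0 x, future x) := by
  unfold timeReversal
  have h : Measurable fun x : ℤ → A => (future x, pastAt 0 x) := by fun_prop
  rw [Measure.map_map h measurable_reverse]
  congr 1
  ext x : 1
  simp only [Function.comp_apply, pastAt_reverse, future_reverse]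

end Reversal

/-! ### The Gram matrix of the internal states -/

section Gram

variable {A : Type*} [Countable A] [Nonempty A] [MeasurableSpace A] [DiscreteMeasurableSpace A]

/-- The joint probability of the causal state `i` of the process and the causal state `a` of the
reversed process, whose law is `ν`, at time `0`. -/
def jointProb (μ ν : Measure (ℤ → A)) [IsProbabilityMeasure μ] [IsProbabilityMeasure ν]
    (i : CausalState μ) (a : CausalState ν) : ℝ :=
  μ.real (pastAt 0 ⁻¹' statePasts μ i ∩ future ⁻¹' statePasts ν a)

variable {μ ν : Measure (ℤ → A)} [IsProbabilityMeasure μ] [IsProbabilityMeasure ν]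

theorem jointProb_comm (hlaw : μ.map (fun x => (future x, pastAt 0 x))
    = ν.map (fun x => (pastAt 0 x, future x))) (i : CausalState μ) (a : CausalState ν) :
    jointProb μ ν i a = jointProb ν μ a i := by
  have h := congrArg (fun m => m (statePasts ν a ×ˢ statePasts μ i)) hlaw
  have hm := (measurableSet_statePasts a).prod (measurableSet_statePasts i)
  rw [Measure.map_apply (by fun_prop) hm, Measure.map_apply (by fun_prop) hm] at h
  unfold jointProb
  rw [Set.inter_comm, measureReal_def, measureReal_def]
  exact congrArg ENNReal.toReal h

/-- The affinity of the laws of the future in the states `i` and `j`: the posterior probabilities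
of `i` and `j` depend on the future only through the causal state of the reversed process. -/
theorem hasSum_sqrt_jointProb (hlaw : μ.map (fun x => (future x, pastAt 0 x))
    = ν.map (fun x => (pastAt 0 x, future x))) (hν : HasDiscreteCausalStates ν)
    (i j : CausalState μ) :
    HasSum (fun a => Real.sqrt (jointProb μ ν i a) * Real.sqrt (jointProb μ ν j a))
      (∫ x, Real.sqrt (posterior 0 i x * posterior 0 j x) ∂μ) := by
  have hm : ∀ a : CausalState ν, MeasurableSet (future ⁻¹' statePasts ν a) := fun a =>
    measurable_future (measurableSet_statePasts a)
  have hκ : condDistrib (pastAt 0) future μ = futureLaw ν := condDistrib_eq_of_map_eq hlaw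
  have hpost : ∀ i : CausalState μ, ∀ᵐ x ∂μ, ∀ a : CausalState ν, future x ∈ statePasts ν a →
      posterior 0 i x = (stateLaw ν a).real (statePasts μ i) := by
    intro i
    have h := condDistrib_ae_eq_condExp (μ := μ) (measurable_future (A := A))
      (measurable_pastAt 0) (measurableSet_statePasts i)
    rw [← stateEvent_eq, hκ] at h
    filter_upwards [h] with x hx a ha
    have ha' : futureLaw ν (future x) = stateLaw ν a := ha
    rw [ha'] at hx
    exact hx.symm
  have hjoint : ∀ (i : CausalState μ) (a : CausalState ν), jointProb μ ν i a
      = (stateLaw ν a).real (statePasts μ i) * μ.real (future ⁻¹' statePasts ν a) := by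
    intro i a
    have h := setIntegral_posterior (μ := μ) 0 i (measurableSet_statePasts a)
    rw [stateEvent_eq] at h
    refine h.symm.trans ?_
    rw [setIntegral_congr_ae (g := fun _ => (stateLaw ν a).real (statePasts μ i)) (hm a)
      (by filter_upwards [hpost i] with x hx using hx a), setIntegral_const, smul_eq_mul, mul_comm]
  -- discreteness of the reversed causal states
  have hcover : (⋃ a, future ⁻¹' statePasts ν a : Set (ℤ → A)) =ᵐ[μ] Set.univ := by
    have hs : MeasurableSet (⋃ a : CausalState ν, statePasts ν a) :=
      MeasurableSet.iUnion measurableSet_statePasts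
    have h1 : ∀ᵐ x ∂ν, pastAt 0 x ∈ ⋃ a : CausalState ν, statePasts ν a := by
      filter_upwards [hν] with x hx
      exact Set.mem_iUnion.2 ⟨⟨_, hx⟩, (causalClass_eq_iff _ _).1 rfl⟩
    have h2 : ∀ᵐ p ∂(ν.map fun x => (pastAt 0 x, future x)),
        p.1 ∈ ⋃ a : CausalState ν, statePasts ν a :=
      (ae_map_iff (by fun_prop) (measurable_fst hs)).2 h1
    rw [← hlaw] at h2
    have h3 := (ae_map_iff (by fun_prop) (measurable_fst hs)).1 h2
    rw [← Set.preimage_iUnion]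
    exact eventuallyEq_univ.2 h3
  have hsum := hasSum_integral_iUnion (μ := μ)
    (f := fun x => Real.sqrt (posterior 0 i x * posterior 0 j x)) hm
    (fun a b hab => Disjoint.preimage _ (Set.disjoint_left.2 fun p ha hb =>
      hab (stateLaw_injective (ha.symm.trans hb)))) (integrable_sqrt_posterior i j).integrableOn
  rw [setIntegral_congr_set hcover, setIntegral_univ] at hsum
  refine hsum.congr_fun fun a => ?_
  rw [setIntegral_congr_ae (g := fun _ => Real.sqrt ((stateLaw ν a).real (statePasts μ i)
    * (stateLaw ν a).real (statePasts μ j))) (hm a)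
    (by filter_upwards [hpost i, hpost j] with x hi hj ha; rw [hi a ha, hj a ha]),
    setIntegral_const, smul_eq_mul, hjoint, hjoint, Real.sqrt_mul measureReal_nonneg,
    Real.sqrt_mul measureReal_nonneg, Real.sqrt_mul measureReal_nonneg]
  nth_rewrite 3 [← Real.mul_self_sqrt
    (measureReal_nonneg (μ := μ) (s := future ⁻¹' statePasts ν a))]
  ring

/-- A finite cryptic order is attained. -/
theorem condStateEntropy_crypticOrder {k : ℕ} (hk : crypticOrder μ = k) :
    condStateEntropy μ k = 0 := by
  have h : crypticOrder μ < ((k + 1 : ℕ) : ℕ∞) := by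
    rw [hk]
    exact_mod_cast Nat.lt_succ_self k
  obtain ⟨l, hl⟩ := iInf_lt_iff.1 h
  obtain ⟨h0, hlk⟩ := iInf_lt_iff.1 hl
  have h1 : (k : ℕ∞) ≤ l := hk ▸ iInf₂_le l h0
  have h2 : l = k := le_antisymm (Nat.lt_succ_iff.1 (by exact_mod_cast hlk)) (by exact_mod_cast h1)
  rwa [← h2]

variable {H : Type*} [NormedAddCommGroup H] [InnerProductSpace ℂ H]

/-- At the cryptic order, finite or not, the futures that do not synchronize two states contribute
nothing to their overlap, which therefore is the full affinity of the two laws of the future. -/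
theorem inner_internalState (hμ : IsStationary μ) {s : CausalState μ → H} (hs : IsQMachine μ s)
    (i j : CausalState μ) :
    ((Real.sqrt (stateProb μ i) * Real.sqrt (stateProb μ j) : ℝ) : ℂ) * inner ℂ (s i) (s j)
      = ((∫ x, Real.sqrt (posterior 0 i x * posterior 0 j x) ∂μ : ℝ) : ℂ) := by
  by_cases htop : crypticOrder μ = ⊤
  · set I := ∫ x, Real.sqrt (posterior 0 i x * posterior 0 j x) ∂μ
    set F : ℕ → ℝ := fun l => ∫ x in future ⁻¹' mergeSet l i j,
      Real.sqrt (posterior 0 i x * posterior 0 j x) ∂μ with hF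
    have h1 : Tendsto (fun l => ENNReal.ofReal ((I - F l) ^ 2)) atTop (𝓝 0) :=
      tendsto_of_tendsto_of_tendsto_of_le_of_le tendsto_const_nhds (tendsto_uncertainty hμ)
        (fun l => bot_le) fun l => sq_integral_sub_le_uncertainty hμ l i j
    have h2 : Tendsto (fun l => (I - F l) ^ 2) atTop (𝓝 0) := by
      have h := (ENNReal.tendsto_toReal ENNReal.zero_ne_top).comp h1
      simpa [Function.comp_def, ENNReal.toReal_ofReal, sq_nonneg] using h
    have h3 : Tendsto F atTop (𝓝 I) := by
      have h := h2.sqrt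
      simp only [Real.sqrt_sq_eq_abs, Real.sqrt_zero] at h
      have h4 := (tendsto_zero_iff_abs_tendsto_zero _).2 h
      simpa using (tendsto_const_nhds (x := I)).sub h4
    have h4 := (hs.2 htop i j).const_mul
      ((Real.sqrt (stateProb μ i) * Real.sqrt (stateProb μ j) : ℝ) : ℂ)
    simp only [inner_qState hμ] at h4
    exact tendsto_nhds_unique h4 ((Complex.continuous_ofReal.tendsto I).comp h3)
  · obtain ⟨k, hk⟩ := ENat.ne_top_iff_exists.1 htop
    rw [hs.1 k hk.symm, inner_qState hμ]
    have h := sq_integral_sub_le_uncertainty hμ k i j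
    rw [uncertainty_eq_zero (condStateEntropy_crypticOrder hk.symm), nonpos_iff_eq_zero,
      ENNReal.ofReal_eq_zero] at h
    have h0 := pow_eq_zero_iff (two_ne_zero) |>.1 (le_antisymm h (sq_nonneg _))
    rw [sub_eq_zero.1 h0]

/-- The vectors `√π_i |S_i⟩`. -/
def weightedState (s : CausalState μ → H) (i : CausalState μ) : H :=
  (Real.sqrt (stateProb μ i) : ℂ) • s i

theorem inner_weightedState (hμ : IsStationary μ) {s : CausalState μ → H} (hs : IsQMachine μ s)
    (i j : CausalState μ) : inner ℂ (weightedState s i) (weightedState s j)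
      = ((∫ x, Real.sqrt (posterior 0 i x * posterior 0 j x) ∂μ : ℝ) : ℂ) := by
  rw [← inner_internalState hμ hs]
  simp only [weightedState, inner_smul_left, inner_smul_right, Complex.conj_ofReal,
    Complex.ofReal_mul]
  ring

theorem summable_norm_sq_weightedState (hμ : IsStationary μ) {s : CausalState μ → H}
    (hs : IsQMachine μ s) : Summable fun i => ‖weightedState s i‖ ^ 2 := by
  refine (hasSum_measureReal_iUnion μ (fun i => measurableSet_stateEvent 0 i)
    (pairwise_disjoint_stateEvent (μ := μ) 0)).summable.congr fun i => ?_
  have h1 : (‖weightedState s i‖ ^ 2 : ℝ)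
      = ∫ x, Real.sqrt (posterior 0 i x * posterior 0 i x) ∂μ := by
    rw [← Complex.ofReal_inj, ← inner_weightedState hμ hs, inner_self_eq_norm_sq_to_K]
    simp
  have h2 := setIntegral_posterior (μ := μ) 0 i MeasurableSet.univ
  simp only [Set.preimage_univ, setIntegral_univ, Set.inter_univ] at h2
  rw [h1]
  refine h2.symm.trans (integral_congr_ae ?_)
  filter_upwards [posterior_nonneg 0 i] with x hx
  rw [Real.sqrt_mul_self hx]

theorem densityOperator_eq (s : CausalState μ → H) : densityOperator μ s
    = ∑' i, InnerProductSpace.rankOne ℂ (weightedState s i) (weightedState s i) := by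
  refine tsum_congr fun i => ?_
  ext x
  simp only [weightedState, _root_.smul_apply, InnerProductSpace.rankOne_apply,
    inner_smul_left, Complex.conj_ofReal, smul_smul]
  congr 1
  rw [mul_right_comm, ← Complex.ofReal_mul, Real.mul_self_sqrt (stateProb_pos i).le]

end Gram

end QMachine

end

theorem mainTheorem3 {A : Type*} [Countable A] [Nonempty A] [MeasurableSpace A]
    [DiscreteMeasurableSpace A] (μ : Measure (ℤ → A)) [IsProbabilityMeasure μ]
    (hμ : QMachine.IsStationary μ)
    (hfwd : QMachine.HasDiscreteCausalStates μ)
    (hrev : QMachine.HasDiscreteCausalStates (QMachine.timeReversal μ))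
    {Hf Hr : Type*} [NormedAddCommGroup Hf] [InnerProductSpace ℂ Hf] [CompleteSpace Hf]
    [NormedAddCommGroup Hr] [InnerProductSpace ℂ Hr] [CompleteSpace Hr]
    (sf : QMachine.CausalState μ → Hf) (hsf : QMachine.IsQMachine μ sf)
    (sr : QMachine.CausalState (QMachine.timeReversal μ) → Hr)
    (hsr : QMachine.IsQMachine (QMachine.timeReversal μ) sr) :
    QMachine.qComplexity μ sf = QMachine.qComplexity (QMachine.timeReversal μ) sr ∧
    QMachine.qStateComplexity μ sf =
      QMachine.qStateComplexity (QMachine.timeReversal μ) sr := by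
  have hν := hμ.timeReversal
  have hlaw := (QMachine.timeReversal_map_past_future μ).symm
  have hlaw' := QMachine.timeReversal_map_future_past μ
  unfold QMachine.qComplexity QMachine.qStateComplexity
  rw [QMachine.densityOperator_eq, QMachine.densityOperator_eq]
  refine QMachine.entropies_eq_of_gram
    (fun i a => Real.sqrt (QMachine.jointProb μ (QMachine.timeReversal μ) i a)) _ _
    (QMachine.summable_norm_sq_weightedState hμ hsf)
    (QMachine.summable_norm_sq_weightedState hν hsr) (fun i j => ?_) (fun i j => ?_)
    (fun a b => ?_) (fun a b => ?_)
  · rw [QMachine.inner_weightedState hμ hsf, Complex.ofReal_re]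
    exact QMachine.hasSum_sqrt_jointProb hlaw hrev i j
  · rw [QMachine.inner_weightedState hμ hsf, Complex.ofReal_im]
  · rw [QMachine.inner_weightedState hν hsr, Complex.ofReal_re]
    simp only [QMachine.jointProb_comm hlaw]
    exact QMachine.hasSum_sqrt_jointProb hlaw' hfwd a b
  · rw [QMachine.inner_weightedState hν hsr, Complex.ofReal_im]
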